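/- **Conventions.** Manifolds are smooth, finite-dimensional, without boundary, Hausdorff and second countable. A *directed graph* $G=(V,E,\mathfrak s,\mathfrak t)$ has maps $\mathfrak s,\mathfrak t\colon V\sqcup E\to V$ that are the identity on $V$. A *graph morphism* $\varphi\colon G\to G'$ is a pair of maps $V\to V'$ and $E\to V'\sqcup E'$ compatible with $\mathfrak s$ and $\mathfrak t$ (so edges may be sent to vertices). A *smooth set* is a subset $A$ of a manifold $M_A$. A *smooth map* $\alpha\colon A\to B$ of smooth sets is an equivalence class of smooth maps $f\colon N\to M_B$, where $N\subset M_A$ is an open neighborhood of $A$ and $f(A)\subset B$; two of them are equivalent if they agree on some open neighborhood of $A$ contained in both domains. It is a *submersion* if some representative is a submersion on its domain. For vector fields $X$ on $M_A$ and $Y$ on $M_B$, it is a *smooth semiconjugacy* from $X$ to $Y$ if some representative $f\colon N\to M_B$ satisfies $Y\circ f=Tf\circ X$ on $N$. A *hybrid system* $H$ consists of a directed graph; for each vertex $v$ a manifold $M_v$, a smooth vector field $X_v$ on $M_v$, a nonempty active set $I_v\subset M_v$ and a (possibly empty) flow set $F_v\subset I_v$; and for each edge $e$ a nonempty guard set $Z_e\subset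 I_{\mathfrak s(e)}$ and an arbitrary function (reset map) $r_e\colon Z_e\to I_{\mathfrak t(e)}$. For a vertex $v$ put $Z_v:=F_v$ and let $r_v\colon F_v\hookrightarrow I_v$ be the inclusion. A *hybrid semiconjugacy* $\alpha\colon H\to K$ consists of a graph morphism $\alpha$ and smooth maps $\alpha_v\colon I^H_v\to I^K_{\alpha(v)}$ of smooth sets, one for each vertex $v$ of $H$, such that 1. for every vertex $v$, $\alpha_v(F^H_v)\subset F^K_{\alpha(v)}$, and the restriction $\alpha_v|_{F^H_v}\colon F_v^H\to F^K_{\alpha(v)}$ is a smooth semiconjugacy from $X^H_v$ to $X^K_{\alpha(v)}$; 2. for every edge $e$, $\alpha_{\mathfrak s(e)}(Z^H_e)\subset Z^K_{\alpha(e)}$, and $r^K_{\alpha(e)}\circ\alpha_{\mathfrak s(e)}=\alpha_{\mathfrak t(e)}\circ r^H_e$ on $Z^H_e$. Hybrid systems and hybrid semiconjugacies, with the evident composition, form a category $\mathbf H$. A *hybrid submersion* is a morphism $p$ of $\mathbf H$ such that every component $p_v$ is a submersion of smooth sets. **Proposition.** If $p\colon K_1\to H$ is a hybrid submersion and $f\colon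 K_2\to H$ is any hybrid semiconjugacy (both in $\mathbf H$), then the fiber product of $K_1\xrightarrow{p}H\xleftarrow{f}K_2$ exists in $\mathbf H$. -/

import Mathlib

open CategoryTheory Set
open scoped Manifold ContDiff

universe u

namespace HybSys

/-! ### Directed graphs; edges may be mapped to vertices -/

/-- A directed graph: source and target on edges, extended to `V ⊔ E` by the identity on `V`. -/
structure DiGraph where
  V : Type u
  E : Type u
  src : E → V
  tgt : E → V

namespace DiGraph

/-- The source map `V ⊔ E → V`, with `src v = v`. -/
def srcExt (G : DiGraph.{u}) : G.V ⊕ G.E → G.V := Sum.elim id G.src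

/-- The target map `V ⊔ E → V`, with `tgt v = v`. -/
def tgtExt (G : DiGraph.{u}) : G.V ⊕ G.E → G.V := Sum.elim id G.tgt

/-- A graph morphism; an edge goes to an edge or to a vertex. -/
@[ext]
structure Hom (G G' : DiGraph.{u}) where
  vert : G.V → G'.V
  edge : G.E → G'.V ⊕ G'.E
  src_edge : ∀ e, G'.srcExt (edge e) = vert (G.src e)
  tgt_edge : ∀ e, G'.tgtExt (edge e) = vert (G.tgt e)

namespace Hom

variable {G G' G'' : DiGraph.{u}}

/-- A graph morphism as a map `V ⊔ E → V' ⊔ E'`. -/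
def ext' (φ : Hom G G') : G.V ⊕ G.E → G'.V ⊕ G'.E :=
  Sum.elim (fun v => Sum.inl (φ.vert v)) φ.edge

theorem srcExt_ext' (φ : Hom G G') (g : G.V ⊕ G.E) :
    G'.srcExt (φ.ext' g) = φ.vert (G.srcExt g) := by
  cases g with
  | inl v => rfl
  | inr e => exact φ.src_edge e

theorem tgtExt_ext' (φ : Hom G G') (g : G.V ⊕ G.E) :
    G'.tgtExt (φ.ext' g) = φ.vert (G.tgtExt g) := by
  cases g with
  | inl v => rfl
  | inr e => exact φ.tgt_edge e

/-- The identity graph morphism. -/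
def id (G : DiGraph.{u}) : Hom G G where
  vert := fun v => v
  edge := Sum.inr
  src_edge := fun _ => rfl
  tgt_edge := fun _ => rfl

/-- Composition of graph morphisms (first `φ`, then `ψ`). -/
def comp (φ : Hom G G') (ψ : Hom G' G'') : Hom G G'' where
  vert := fun v => ψ.vert (φ.vert v)
  edge := fun e => ψ.ext' (φ.edge e)
  src_edge := fun e => by rw [srcExt_ext', φ.src_edge]
  tgt_edge := fun e => by rw [tgtExt_ext', φ.tgt_edge]

end Hom

end DiGraph

/-! ### Manifolds, smooth sets and germs of smooth maps -/

/-- A smooth manifold without boundary (finite-dimensional, Hausdorff, second countable). -/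
structure Mfd where
  carrier : Type u
  dim : ℕ
  [top : TopologicalSpace carrier]
  [charted : ChartedSpace (EuclideanSpace ℝ (Fin dim)) carrier]
  [mfd : IsManifold (𝓡 dim) ∞ carrier]
  [t2 : T2Space carrier]
  [sc : SecondCountableTopology carrier]

instance : CoeSort Mfd.{u} (Type u) := ⟨Mfd.carrier⟩

attribute [instance] Mfd.top Mfd.charted Mfd.mfd Mfd.t2 Mfd.sc

/-- A smooth vector field on a manifold. -/
structure VectorField (M : Mfd.{u}) where
  toFun : ∀ x : M, TangentSpace (𝓡 M.dim) x
  smooth : ContMDiff (𝓡 M.dim) (𝓡 M.dim).tangent ∞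
    (fun x => (⟨x, toFun x⟩ : TangentBundle (𝓡 M.dim) M))

/-- A smooth set: an arbitrary subset of a manifold. -/
structure SmoothSet where
  ambient : Mfd.{u}
  carrier : Set ambient

/-- A representative of a smooth map `A → B`: a smooth map to the ambient manifold of `B`, defined
on an open neighbourhood `dom` of `A` and sending `A` into `B`.  The function is stored with
arbitrary values off `dom`; these values are never used.  (Such values exist, because `B` is
nonempty wherever smooth maps of smooth sets are used below: active sets are nonempty.) -/
structure SmoothRep (A B : SmoothSet.{u}) where
  dom : Set A.ambient
  isOpen_dom : IsOpen dom
  subset_dom : A.carrier ⊆ dom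
  toFun : A.ambient → B.ambient
  smooth : ContMDiffOn (𝓡 A.ambient.dim) (𝓡 B.ambient.dim) ∞ toFun dom
  mapsTo : MapsTo toFun A.carrier B.carrier

namespace SmoothRep

variable {A B C : SmoothSet.{u}}

/-- Germ-equivalence on `A`: agreement on some open neighbourhood of `A` inside both domains. -/
def GermEquiv (f g : SmoothRep A B) : Prop :=
  ∃ U : Set A.ambient, IsOpen U ∧ A.carrier ⊆ U ∧ U ⊆ f.dom ∩ g.dom ∧ EqOn f.toFun g.toFun U

instance setoid (A B : SmoothSet.{u}) : Setoid (SmoothRep A B) where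
  r := GermEquiv
  iseqv :=
    { refl := fun f => ⟨f.dom, f.isOpen_dom, f.subset_dom, fun _ hx => ⟨hx, hx⟩, fun _ _ => rfl⟩
      symm := fun ⟨U, h1, h2, h3, h4⟩ => ⟨U, h1, h2, fun _ hx => ⟨(h3 hx).2, (h3 hx).1⟩, h4.symm⟩
      trans := fun ⟨U, h1, h2, h3, h4⟩ ⟨U', k1, k2, k3, k4⟩ =>
        ⟨U ∩ U', h1.inter k1, subset_inter h2 k2, fun _ hx => ⟨(h3 hx.1).1, (k3 hx.2).2⟩,
          fun _ hx => (h4 hx.1).trans (k4 hx.2)⟩ }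

/-- The identity, defined on the whole ambient manifold. -/
def id (A : SmoothSet.{u}) : SmoothRep A A where
  dom := univ
  isOpen_dom := isOpen_univ
  subset_dom := subset_univ _
  toFun := fun x => x
  smooth := contMDiffOn_id
  mapsTo := fun _ hx => hx

/-- Composition, defined on the preimage of the second domain (first `f`, then `g`). -/
def comp (f : SmoothRep A B) (g : SmoothRep B C) : SmoothRep A C where
  dom := f.dom ∩ f.toFun ⁻¹' g.dom
  isOpen_dom := f.smooth.continuousOn.isOpen_inter_preimage f.isOpen_dom g.isOpen_dom
  subset_dom := fun _ hx => ⟨f.subset_dom hx, g.subset_dom (f.mapsTo hx)⟩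
  toFun := fun x => g.toFun (f.toFun x)
  smooth := g.smooth.comp (f.smooth.mono inter_subset_left) inter_subset_right
  mapsTo := fun _ hx => g.mapsTo (f.mapsTo hx)

theorem comp_equiv {f f' : SmoothRep A B} {g g' : SmoothRep B C} (hf : f ≈ f') (hg : g ≈ g') :
    f.comp g ≈ f'.comp g' := by
  obtain ⟨U, h1, h2, h3, h4⟩ := hf
  obtain ⟨W, k1, k2, k3, k4⟩ := hg
  refine ⟨U ∩ f.toFun ⁻¹' W, ?_, ?_, ?_, ?_⟩
  · exact (f.smooth.continuousOn.mono fun x hx => (h3 hx).1).isOpen_inter_preimage h1 k1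
  · exact fun x hx => ⟨h2 hx, k2 (f.mapsTo hx)⟩
  · rintro x ⟨hx, hx'⟩
    refine ⟨⟨(h3 hx).1, (k3 hx').1⟩, (h3 hx).2, ?_⟩
    change f'.toFun x ∈ g'.dom
    rw [← h4 hx]
    exact (k3 hx').2
  · rintro x ⟨hx, hx'⟩
    change g.toFun (f.toFun x) = g'.toFun (f'.toFun x)
    rw [← h4 hx]
    exact k4 hx'

/-- The same representative, restricted to a subset `S` of `A`. -/
def restrict (f : SmoothRep A B) (S : Set A.ambient) (hS : S ⊆ A.carrier) :
    SmoothRep ⟨A.ambient, S⟩ B where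
  dom := f.dom
  isOpen_dom := f.isOpen_dom
  subset_dom := hS.trans f.subset_dom
  toFun := f.toFun
  smooth := f.smooth
  mapsTo := fun _ hx => f.mapsTo (hS hx)

end SmoothRep

/-- A smooth map of smooth sets: a germ-equivalence class of representatives. -/
def SmoothMap (A B : SmoothSet.{u}) : Type u := Quotient (SmoothRep.setoid A B)

namespace SmoothMap

variable {A B C D : SmoothSet.{u}}

/-- `f` represents the smooth map `α`. -/
def Represents (f : SmoothRep A B) (α : SmoothMap A B) : Prop := Quotient.mk _ f = α

/-- The underlying map of sets `A → B`. -/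
def apply (α : SmoothMap A B) : A.carrier → B.carrier :=
  Quotient.lift (fun f : SmoothRep A B => fun x : A.carrier =>
    (⟨f.toFun x, f.mapsTo x.2⟩ : B.carrier))
    (fun f g h => funext fun x => by
      obtain ⟨_, _, h2, _, h4⟩ : SmoothRep.GermEquiv f g := h
      exact Subtype.ext (h4 (h2 x.2))) α

/-- The identity smooth map. -/
def id (A : SmoothSet.{u}) : SmoothMap A A := Quotient.mk _ (SmoothRep.id A)

/-- Composition of smooth maps (first `α`, then `β`). -/
def comp (α : SmoothMap A B) (β : SmoothMap B C) : SmoothMap A C :=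
  Quotient.map₂ SmoothRep.comp (fun _ _ hf _ _ hg => SmoothRep.comp_equiv hf hg) α β

/-- The restriction of a smooth map to a subset `S` of `A`. -/
def restrict (α : SmoothMap A B) (S : Set A.ambient) (hS : S ⊆ A.carrier) :
    SmoothMap ⟨A.ambient, S⟩ B :=
  Quotient.map (fun f : SmoothRep A B => f.restrict S hS)
    (fun f g h => by
      obtain ⟨U, h1, h2, h3, h4⟩ : SmoothRep.GermEquiv f g := h
      exact ⟨U, h1, hS.trans h2, h3, h4⟩) α

/-- A submersion: some representative is a submersion on its whole (open) domain. -/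
def IsSubmersion (α : SmoothMap A B) : Prop :=
  ∃ f : SmoothRep A B, Represents f α ∧ ∀ x ∈ f.dom,
    Function.Surjective (mfderiv (𝓡 A.ambient.dim) (𝓡 B.ambient.dim) f.toFun x)

/-- A smooth semiconjugacy from `X` to `Y`: some representative `f` satisfies `Y ∘ f = Tf ∘ X` on
its whole (open) domain. -/
def IsSemiconjugacy (α : SmoothMap A B) (X : VectorField A.ambient) (Y : VectorField B.ambient) :
    Prop :=
  ∃ f : SmoothRep A B, Represents f α ∧ ∀ x ∈ f.dom,
    mfderiv (𝓡 A.ambient.dim) (𝓡 B.ambient.dim) f.toFun x (X.toFun x) = Y.toFun (f.toFun x)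

@[simp] theorem apply_id (x : A.carrier) : (id A).apply x = x := rfl

@[simp] theorem apply_comp (α : SmoothMap A B) (β : SmoothMap B C) (x : A.carrier) :
    (α.comp β).apply x = β.apply (α.apply x) := by
  induction α using Quotient.inductionOn with
  | h f => induction β using Quotient.inductionOn with
    | h g => rfl

theorem id_comp (α : SmoothMap A B) : (id A).comp α = α := by
  induction α using Quotient.inductionOn with
  | h f => exact Quotient.sound ⟨f.dom, f.isOpen_dom, f.subset_dom,
      fun _ hx => ⟨⟨trivial, hx⟩, hx⟩, fun _ _ => rfl⟩

theorem comp_id (α : SmoothMap A B) : α.comp (id B) = α := by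
  induction α using Quotient.inductionOn with
  | h f => exact Quotient.sound ⟨f.dom, f.isOpen_dom, f.subset_dom,
      fun _ hx => ⟨⟨hx, trivial⟩, hx⟩, fun _ _ => rfl⟩

theorem comp_assoc (α : SmoothMap A B) (β : SmoothMap B C) (γ : SmoothMap C D) :
    (α.comp β).comp γ = α.comp (β.comp γ) := by
  induction α using Quotient.inductionOn with
  | h f => induction β using Quotient.inductionOn with
    | h g => induction γ using Quotient.inductionOn with
      | h k => exact Quotient.sound ⟨_, ((f.comp g).comp k).isOpen_dom,
          ((f.comp g).comp k).subset_dom,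
          fun _ hx => ⟨hx, hx.1.1, hx.1.2, hx.2⟩, fun _ _ => rfl⟩

theorem isSemiconjugacy_id (X : VectorField A.ambient) (S : Set A.ambient) (hS : S ⊆ A.carrier) :
    ((id A).restrict S hS).IsSemiconjugacy X X := by
  refine ⟨(SmoothRep.id A).restrict S hS, rfl, fun x _ => ?_⟩
  change mfderiv _ _ (fun y : A.ambient => y) x (X.toFun x) = _
  have : mfderiv (𝓡 A.ambient.dim) (𝓡 A.ambient.dim) (fun y : A.ambient => y) x
      = ContinuousLinearMap.id ℝ (TangentSpace (𝓡 A.ambient.dim) x) := mfderiv_id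
  rw [this]
  rfl

theorem IsSemiconjugacy.comp {α : SmoothMap A B} {β : SmoothMap B C} {X : VectorField A.ambient}
    {Y : VectorField B.ambient} {W : VectorField C.ambient} {S : Set A.ambient}
    {T : Set B.ambient} {hS : S ⊆ A.carrier} {hT : T ⊆ B.carrier}
    (hST : ∀ x : A.carrier, (x : A.ambient) ∈ S → (α.apply x : B.ambient) ∈ T)
    (hα : (α.restrict S hS).IsSemiconjugacy X Y) (hβ : (β.restrict T hT).IsSemiconjugacy Y W) :
    ((α.comp β).restrict S hS).IsSemiconjugacy X W := by
  induction α using Quotient.inductionOn with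
  | h a => induction β using Quotient.inductionOn with
    | h b =>
      obtain ⟨f, hf, hfX⟩ := hα
      obtain ⟨g, hg, hgX⟩ := hβ
      obtain ⟨U, hU, hSU, hUd, hUe⟩ := Quotient.exact hf
      obtain ⟨U', hU', hTU', hUd', hUe'⟩ := Quotient.exact hg
      have hmaps : ∀ x ∈ S, f.toFun x ∈ T := by
        intro x hx
        rw [hUe (hSU hx)]
        exact hST ⟨x, hS hx⟩ hx
      have hopen : IsOpen (f.dom ∩ f.toFun ⁻¹' g.dom) :=
        f.smooth.continuousOn.isOpen_inter_preimage f.isOpen_dom g.isOpen_dom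
      refine ⟨{ dom := f.dom ∩ f.toFun ⁻¹' g.dom
                isOpen_dom := hopen
                subset_dom := fun x hx => ⟨f.subset_dom hx, g.subset_dom (hmaps x hx)⟩
                toFun := fun x => g.toFun (f.toFun x)
                smooth := g.smooth.comp (f.smooth.mono inter_subset_left) inter_subset_right
                mapsTo := fun x hx => g.mapsTo (hmaps x hx) }, ?_, ?_⟩
      · refine Quotient.sound ⟨U ∩ f.toFun ⁻¹' U', ?_, ?_, ?_, ?_⟩
        · exact (f.smooth.continuousOn.mono fun x hx => (hUd hx).1).isOpen_inter_preimage hU hU'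
        · exact fun x hx => ⟨hSU hx, hTU' (hmaps x hx)⟩
        · rintro x ⟨hx, hx'⟩
          refine ⟨⟨(hUd hx).1, (hUd' hx').1⟩, (hUd hx).2, ?_⟩
          change a.toFun x ∈ b.dom
          have : f.toFun x = a.toFun x := hUe hx
          rw [← this]
          exact (hUd' hx').2
        · rintro x ⟨hx, hx'⟩
          change g.toFun (f.toFun x) = b.toFun (a.toFun x)
          have : f.toFun x = a.toFun x := hUe hx
          rw [← this]
          exact hUe' hx'
      · rintro x ⟨hx, hx'⟩
        have h1 : MDifferentiableAt (𝓡 A.ambient.dim) (𝓡 B.ambient.dim) f.toFun x :=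
          (f.smooth.contMDiffAt (f.isOpen_dom.mem_nhds hx)).mdifferentiableAt (by simp)
        have h2 : MDifferentiableAt (𝓡 B.ambient.dim) (𝓡 C.ambient.dim) g.toFun (f.toFun x) :=
          (g.smooth.contMDiffAt (g.isOpen_dom.mem_nhds hx')).mdifferentiableAt (by simp)
        have h3 : mfderiv (𝓡 A.ambient.dim) (𝓡 C.ambient.dim) (fun y => g.toFun (f.toFun y)) x
            = (mfderiv (𝓡 B.ambient.dim) (𝓡 C.ambient.dim) g.toFun (f.toFun x)).comp
              (mfderiv (𝓡 A.ambient.dim) (𝓡 B.ambient.dim) f.toFun x) := mfderiv_comp x h2 h1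
        change mfderiv (𝓡 A.ambient.dim) (𝓡 C.ambient.dim) (fun y => g.toFun (f.toFun y)) x
          (X.toFun x) = W.toFun (g.toFun (f.toFun x))
        rw [h3, ← hgX _ hx', ← hfX x hx]
        rfl

end SmoothMap

/-! ### Hybrid systems -/

/-- A hybrid system, possibly with empty active sets or guard sets. -/
structure HybridData where
  graph : DiGraph.{u}
  mode : graph.V → Mfd.{u}
  field : ∀ v, VectorField (mode v)
  active : ∀ v, Set (mode v)
  flow : ∀ v, Set (mode v)
  flow_subset : ∀ v, flow v ⊆ active v
  guard : ∀ e, Set (mode (graph.src e))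
  guard_subset : ∀ e, guard e ⊆ active (graph.src e)
  reset : ∀ e, guard e → active (graph.tgt e)

namespace HybridData

/-- The smooth set `I_v`. -/
abbrev activeSet (H : HybridData.{u}) (v : H.graph.V) : SmoothSet.{u} := ⟨H.mode v, H.active v⟩

/-- The set of states `⨆ v, I_v`. -/
abbrev State (H : HybridData.{u}) : Type u := Σ v, H.active v

/-- `H.Resets g x y` says that `x` lies in the guard set `Z_g` and that `r_g x = y`.  For a vertex
`v`, the guard set `Z_v` is the flow set `F_v` and `r_v` is the inclusion of `F_v` in `I_v`. -/
inductive Resets (H : HybridData.{u}) : H.graph.V ⊕ H.graph.E → H.State → H.State → Prop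
  | vertex (v : H.graph.V) (x : H.active v) (hx : (x : H.mode v) ∈ H.flow v) :
      Resets H (Sum.inl v) ⟨v, x⟩ ⟨v, x⟩
  | edge (e : H.graph.E) (z : H.guard e) :
      Resets H (Sum.inr e) ⟨H.graph.src e, ⟨z, H.guard_subset e z.2⟩⟩
        ⟨H.graph.tgt e, H.reset e z⟩

end HybridData

/-- The map of states given by a graph morphism and smooth maps of active sets. -/
def stateMap {H K : HybridData.{u}} (φ : DiGraph.Hom H.graph K.graph)
    (α : ∀ v, SmoothMap (H.activeSet v) (K.activeSet (φ.vert v))) (x : H.State) : K.State :=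
  ⟨φ.vert x.1, (α x.1).apply x.2⟩

/-- A hybrid semiconjugacy.  The last field says that for each edge `e` the map takes `Z_e` into
`Z_{φ e}`, and that it intertwines `r_e` with `r_{φ e}`. -/
structure Semiconj (H K : HybridData.{u}) where
  graph : DiGraph.Hom H.graph K.graph
  map : ∀ v, SmoothMap (H.activeSet v) (K.activeSet (graph.vert v))
  map_flow : ∀ v (x : H.active v), (x : H.mode v) ∈ H.flow v →
    ((map v).apply x).1 ∈ K.flow (graph.vert v)
  map_field : ∀ v, ((map v).restrict (H.flow v) (H.flow_subset v)).IsSemiconjugacy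
    (H.field v) (K.field (graph.vert v))
  map_reset : ∀ (e : H.graph.E) (z : H.guard e),
    K.Resets (graph.edge e)
      (stateMap graph map ⟨H.graph.src e, ⟨z, H.guard_subset e z.2⟩⟩)
      (stateMap graph map ⟨H.graph.tgt e, H.reset e z⟩)

namespace Semiconj

variable {H K L : HybridData.{u}}

theorem ext_of {α β : Semiconj H K} (hv : α.graph.vert = β.graph.vert)
    (he : α.graph.edge = β.graph.edge) (hm : ∀ v, HEq (α.map v) (β.map v)) : α = β := by
  obtain ⟨⟨a1, a2, a3, a4⟩, a, _, _, _⟩ := α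
  obtain ⟨⟨b1, b2, b3, b4⟩, b, _, _, _⟩ := β
  simp only at hv he
  subst hv he
  have : a = b := funext fun v => eq_of_heq (hm v)
  subst this
  rfl

theorem map_resets (α : Semiconj H K) {g : H.graph.V ⊕ H.graph.E} {x y : H.State}
    (h : H.Resets g x y) :
    K.Resets (α.graph.ext' g) (stateMap α.graph α.map x) (stateMap α.graph α.map y) := by
  cases h with
  | vertex v x hx => exact .vertex _ _ (α.map_flow v x hx)
  | edge e z => exact α.map_reset e z

/-- The identity semiconjugacy. -/
def id (H : HybridData.{u}) : Semiconj H H where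
  graph := DiGraph.Hom.id H.graph
  map := fun v => SmoothMap.id (H.activeSet v)
  map_flow := fun _ _ hx => hx
  map_field := fun v =>
    SmoothMap.isSemiconjugacy_id (A := H.activeSet v) (H.field v) (H.flow v) (H.flow_subset v)
  map_reset := fun e z => .edge e z

/-- Composition of semiconjugacies (first `α`, then `β`). -/
def comp (α : Semiconj H K) (β : Semiconj K L) : Semiconj H L where
  graph := α.graph.comp β.graph
  map := fun v => (α.map v).comp (β.map (α.graph.vert v))
  map_flow := fun v x hx => by
    have h := β.map_flow _ _ (α.map_flow v x hx)
    have hc := SmoothMap.apply_comp (α.map v) (β.map (α.graph.vert v)) x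
    exact (congrArg Subtype.val hc) ▸ h
  map_field := fun v => SmoothMap.IsSemiconjugacy.comp (α.map_flow v) (α.map_field v)
    (β.map_field (α.graph.vert v))
  map_reset := fun e z => by
    have h := β.map_resets (α.map_reset e z)
    have hc : ∀ x : H.State, stateMap (α.graph.comp β.graph)
        (fun v => (α.map v).comp (β.map (α.graph.vert v))) x =
          stateMap β.graph β.map (stateMap α.graph α.map x) := fun x =>
      Sigma.ext rfl (heq_of_eq (SmoothMap.apply_comp _ _ _))
    rw [hc, hc]
    exact h

end Semiconj

/-- The objects of the category `H` of hybrid systems: no active set and no guard set is empty. -/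
structure HybridSystem extends HybridData.{u} where
  active_nonempty : ∀ v, (active v).Nonempty
  guard_nonempty : ∀ e, (guard e).Nonempty

/-- The category of hybrid systems and hybrid semiconjugacies. -/
instance : Category.{u} HybridSystem.{u} where
  Hom H K := Semiconj H.toHybridData K.toHybridData
  id H := Semiconj.id H.toHybridData
  comp α β := Semiconj.comp α β
  id_comp α := Semiconj.ext_of rfl rfl fun _ => heq_of_eq (SmoothMap.id_comp _)
  comp_id α := Semiconj.ext_of rfl
    (funext fun e => by
      change (DiGraph.Hom.id _).ext' (α.graph.edge e) = α.graph.edge e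
      cases α.graph.edge e <;> rfl)
    fun _ => heq_of_eq (SmoothMap.comp_id _)
  assoc α β γ := Semiconj.ext_of rfl
    (funext fun e => by
      change γ.graph.ext' (β.graph.ext' (α.graph.edge e)) =
        (β.graph.comp γ.graph).ext' (α.graph.edge e)
      cases α.graph.edge e <;> rfl)
    fun _ => heq_of_eq (SmoothMap.comp_assoc _ _ _)

/-- A hybrid submersion: every component is a submersion of smooth sets. -/
def IsHybridSubmersion {H K : HybridSystem.{u}} (p : H ⟶ K) : Prop :=
  ∀ v, (Semiconj.map p v).IsSubmersion

end HybSys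

/-! The fiber product is built mode by mode. Over a pair of vertices with the same image, represent
the two smooth maps by `p` on an open `D₁`, where `p` is a submersion, and `f` on an open `D₂`. The
set `p x₁ = f x₂` in `D₁ × D₂` is then an embedded submanifold of the product, with tangent space
`{(v₁, v₂) | Tp v₁ = Tf v₂}` (`exists_manifold_fiberSet`). Its points over both active sets form the
new active set. The universal property holds for germs: if two composites agree as germs, they agree
on an open neighbourhood, so the pair of maps takes that neighbourhood into the submanifold.

The vector field needs care. The semiconjugacy equations hold only near the flow sets, so `X₁ × X₂`
need not be tangent to the submanifold elsewhere. A smooth field on the submanifold that equals `X₁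
× X₂` wherever the latter is tangent is glued from local ones by a partition of unity
(`exists_vectorField`). Since the new flow set lies over `F₁ × F₂`, the other values do not matter.

The graph is the fiber product of the extended sets `V ⊔ E`, a pair of two vertices counting as a
vertex and any other pair as an edge. Only pairs with a nonempty fiber product of active sets or of
guards are kept, as the category requires. No cone is lost, because the active sets and guards of
its apex are nonempty and their points witness that the pairs in question were kept. Resets, seen as
deterministic relations on states, lift to the fiber product because `p` and `f` intertwine them
with the same reset of `H` (`onState_eq_of_resets`). -/

namespace HybSys

/-! ### Slices of manifolds -/

/-! ### The local normal form of a submersion -/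

section LinearAlgebra

variable {E F : Type*} [NormedAddCommGroup E] [NormedSpace ℝ E] [FiniteDimensional ℝ E]
  [NormedAddCommGroup F] [NormedSpace ℝ F] [FiniteDimensional ℝ F]

/-- A surjective linear map is, up to an isomorphism, the projection of a product. -/
theorem exists_equiv_prod_fst_eq (L : E →L[ℝ] F) (hL : Function.Surjective L) {k : ℕ}
    (hk : Module.finrank ℝ E = Module.finrank ℝ F + k) :
    ∃ e : E ≃L[ℝ] F × EuclideanSpace ℝ (Fin k), ∀ x, (e x).1 = L x := by
  have hr : L.toLinearMap.range = ⊤ := LinearMap.range_eq_top.2 hL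
  have h1 := L.toLinearMap.finrank_range_add_finrank_ker
  rw [hr, finrank_top] at h1
  -- A linear projection onto the kernel. If `L x = 0` then `π x = x`, so `(L, π)` is injective; the
  -- dimensions agree by hypothesis.
  obtain ⟨π, hπ⟩ := L.toLinearMap.ker.subtype.exists_leftInverse_of_injective
    (LinearMap.ker_eq_bot.2 (Submodule.subtype_injective _))
  let c : L.toLinearMap.ker ≃ₗ[ℝ] EuclideanSpace ℝ (Fin k) :=
    LinearEquiv.ofFinrankEq _ _ (by rw [finrank_euclideanSpace_fin]; omega)
  let m : E →ₗ[ℝ] F × EuclideanSpace ℝ (Fin k) := L.toLinearMap.prod (c.toLinearMap ∘ₗ π)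
  have hm : Function.Injective m := by
    rw [← LinearMap.ker_eq_bot, LinearMap.ker_eq_bot']
    intro x hx
    obtain ⟨h2, h3⟩ := Prod.mk.inj hx
    have h4 : π x = 0 := c.map_eq_zero_iff.1 h3
    have h5 : π x = ⟨x, h2⟩ := LinearMap.congr_fun hπ (⟨x, h2⟩ : L.toLinearMap.ker)
    exact congrArg Subtype.val (h5.symm.trans h4)
  exact ⟨(LinearEquiv.ofInjectiveOfFinrankEq m hm (by simp [hk])).toContinuousLinearEquiv,
    fun x => rfl⟩

/-- A map with surjective derivative is locally the projection of a product. -/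
theorem exists_openPartialHomeomorph_fst_eq {G : E → F} {O : Set E} (hO : IsOpen O)
    (hG : ContDiffOn ℝ ∞ G O) {a : E} (ha : a ∈ O) (hs : Function.Surjective (fderiv ℝ G a))
    {k : ℕ} (hk : Module.finrank ℝ E = Module.finrank ℝ F + k) :
    ∃ Φ : OpenPartialHomeomorph E (F × EuclideanSpace ℝ (Fin k)), a ∈ Φ.source ∧ Φ.source ⊆ O ∧
      ContDiffOn ℝ ∞ Φ Φ.source ∧ ContDiffOn ℝ ∞ Φ.symm Φ.target ∧ ∀ x, (Φ x).1 = G x := by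
  obtain ⟨e, he⟩ := exists_equiv_prod_fst_eq _ hs hk
  -- `G` is completed by the complementary linear coordinates of `e`, so that the derivative at `a`
  -- is exactly `e` and the inverse function theorem applies.
  set P : E → F × EuclideanSpace ℝ (Fin k) := fun x => (G x, (e x).2) with hP
  have hPs : ContDiffOn ℝ ∞ P O :=
    hG.prodMk ((contDiff_snd.comp e.contDiff).contDiffOn)
  have hGa := hG.contDiffAt (hO.mem_nhds ha)
  have hPa := hPs.contDiffAt (hO.mem_nhds ha)
  have hd : HasFDerivAt P (e : E →L[ℝ] F × EuclideanSpace ℝ (Fin k)) a := by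
    have h1 : HasFDerivAt P _ a := (hGa.differentiableAt (by simp)).hasFDerivAt.prodMk
      (((ContinuousLinearMap.snd ℝ F (EuclideanSpace ℝ (Fin k))).comp
        (e : E →L[ℝ] F × EuclideanSpace ℝ (Fin k))).hasFDerivAt)
    convert h1 using 1
    ext x
    · exact he x
    · rfl
  have hds : HasStrictFDerivAt P (e : E →L[ℝ] F × EuclideanSpace ℝ (Fin k)) a :=
    hPa.hasStrictFDerivAt' hd (by simp)
  have hc : ContinuousOn (fderiv ℝ P) O := hPs.continuousOn_fderiv_of_isOpen hO (by simp)
  -- Shrinking to the open set where the derivative is invertible makes the inverse smooth on the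
  -- whole target, not only at the image of `a`.
  have hU : IsOpen (O ∩ fderiv ℝ P ⁻¹' Set.range ((↑) : (E ≃L[ℝ] F × EuclideanSpace ℝ (Fin k)) → _)) :=
    hc.isOpen_inter_preimage hO ContinuousLinearEquiv.isOpen
  refine ⟨(hds.toOpenPartialHomeomorph P).restrOpen _ hU, ?_, ?_, ?_, ?_, fun x => rfl⟩
  · exact ⟨hds.mem_toOpenPartialHomeomorph_source, ha, by rw [mem_preimage, hd.fderiv]; exact ⟨e, rfl⟩⟩
  · exact fun x hx => hx.2.1
  · exact hPs.mono fun x hx => hx.2.1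
  · intro y hy
    set Φ := (hds.toOpenPartialHomeomorph P).restrOpen _ hU
    obtain ⟨-, h1, e', h2⟩ := Φ.map_target hy
    have h3 := hPs.contDiffAt (hO.mem_nhds h1)
    refine (Φ.contDiffAt_symm hy (f₀' := e') ?_ h3).contDiffWithinAt
    rw [h2]
    exact (h3.differentiableAt (by simp)).hasFDerivAt

end LinearAlgebra

/-! ### Slice charts and the manifold structure they define -/

section Slice

variable {E : Type*} [NormedAddCommGroup E] [NormedSpace ℝ E] {H : Type*} [TopologicalSpace H]
  {N : Type*} [TopologicalSpace N] [ChartedSpace H N]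

/-- A smooth chart of a subset `S` of a manifold that extends to an open set of the manifold. -/
structure SliceChart (I : ModelWithCorners ℝ E H) (S : Set N) (k : ℕ) where
  source : Set N
  target : Set (EuclideanSpace ℝ (Fin k))
  toFun : N → EuclideanSpace ℝ (Fin k)
  invFun : EuclideanSpace ℝ (Fin k) → N
  isOpen_source : IsOpen source
  isOpen_target : IsOpen target
  smooth_toFun : ContMDiffOn I (𝓡 k) ∞ toFun source
  smooth_invFun : ContMDiffOn (𝓡 k) I ∞ invFun target
  mapsTo : MapsTo toFun (S ∩ source) target
  mapsTo_inv : MapsTo invFun target (S ∩ source)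
  left_inv : ∀ x ∈ S ∩ source, invFun (toFun x) = x
  right_inv : ∀ y ∈ target, toFun (invFun y) = y

namespace SliceChart

variable {I : ModelWithCorners ℝ E H} {S : Set N} {k : ℕ} (c : SliceChart I S k)

open Classical in
/-- The inverse of a slice chart, with values in the subset. -/
noncomputable def inv (x₀ : S) (y : EuclideanSpace ℝ (Fin k)) : S :=
  -- The value `x₀` off the target is never used.
  if h : y ∈ c.target then ⟨c.invFun y, (c.mapsTo_inv h).1⟩ else x₀

theorem coe_inv (x₀ : S) {y : EuclideanSpace ℝ (Fin k)} (h : y ∈ c.target) :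
    (c.inv x₀ y : N) = c.invFun y := by
  rw [inv, dif_pos h]

/-- The chart of the subset given by a slice chart. -/
noncomputable def toOpenPartialHomeomorph (x₀ : S) :
    OpenPartialHomeomorph S (EuclideanSpace ℝ (Fin k)) where
  toFun x := c.toFun x
  invFun := c.inv x₀
  source := ((↑) : S → N) ⁻¹' c.source
  target := c.target
  map_source' x hx := c.mapsTo ⟨x.2, hx⟩
  map_target' y hy := by
    rw [mem_preimage, c.coe_inv x₀ hy]
    exact (c.mapsTo_inv hy).2
  left_inv' x hx := Subtype.ext <| by
    rw [c.coe_inv x₀ (c.mapsTo ⟨x.2, hx⟩), c.left_inv x ⟨x.2, hx⟩]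
  right_inv' y hy := by rw [c.coe_inv x₀ hy, c.right_inv y hy]
  open_source := c.isOpen_source.preimage continuous_subtype_val
  open_target := c.isOpen_target
  continuousOn_toFun := c.smooth_toFun.continuousOn.comp continuous_subtype_val.continuousOn
    fun _ hx => hx
  continuousOn_invFun := Topology.IsInducing.subtypeVal.continuousOn_iff.2 <|
    c.smooth_invFun.continuousOn.congr fun _ hy => c.coe_inv x₀ hy

/-- The charted space structure given by slice charts at all points. -/
@[reducible]
noncomputable def chartedSpace (c : S → SliceChart I S k) (hc : ∀ x, (x : N) ∈ (c x).source) :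
    ChartedSpace (EuclideanSpace ℝ (Fin k)) S where
  atlas := range fun x => (c x).toOpenPartialHomeomorph x
  chartAt x := (c x).toOpenPartialHomeomorph x
  mem_chart_source x := hc x
  chart_mem_atlas x := ⟨x, rfl⟩

variable (c : S → SliceChart I S k) (hc : ∀ x, (x : N) ∈ (c x).source)

/-- A transition map is the `invFun` of one slice chart followed by the `toFun` of another. Both are
smooth as maps from and to the ambient manifold, so their composition is smooth. -/
theorem isManifold : @IsManifold _ _ _ _ _ _ _ (𝓡 k) ∞ S _ (chartedSpace c hc) := by
  let _ := chartedSpace c hc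
  refine isManifold_of_contDiffOn _ _ _ ?_
  rintro _ _ ⟨x, rfl⟩ ⟨x', rfl⟩
  simp only [modelWithCornersSelf_coe, modelWithCornersSelf_coe_symm, range_id, preimage_id,
    inter_univ, Function.comp_id, Function.id_comp]
  rw [← contMDiffOn_iff_contDiffOn]
  have h : ContMDiffOn (𝓡 k) (𝓡 k) ∞ ((c x').toFun ∘ (c x).invFun)
      ((c x).target ∩ (c x).invFun ⁻¹' (c x').source) :=
    (c x').smooth_toFun.comp ((c x).smooth_invFun.mono inter_subset_left) inter_subset_right
  refine (h.mono ?_).congr ?_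
  · rintro y ⟨hy, hy'⟩
    refine ⟨hy, ?_⟩
    rw [mem_preimage, ← (c x).coe_inv x hy]
    exact hy'
  · rintro y ⟨hy, -⟩
    exact congrArg (c x').toFun ((c x).coe_inv x hy)

theorem contMDiff_subtype_val :
    letI := chartedSpace c hc
    ContMDiff (𝓡 k) I ∞ ((↑) : S → N) := by
  let _ := chartedSpace c hc
  have := isManifold c hc
  intro x
  have h1 : ContMDiffOn (𝓡 k) (𝓡 k) ∞ (fun y : S => (c x).toFun y) ((↑) ⁻¹' (c x).source) :=
    contMDiffOn_chart (I := 𝓡 k) (x := x)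
  have h2 : ContMDiffOn (𝓡 k) I ∞ (fun y : S => (c x).invFun ((c x).toFun y))
      ((↑) ⁻¹' (c x).source) :=
    (c x).smooth_invFun.comp h1 fun y hy => (c x).mapsTo ⟨y.2, hy⟩
  exact (h2.congr fun y hy => ((c x).left_inv y ⟨y.2, hy⟩).symm).contMDiffAt
    (((c x).isOpen_source.preimage continuous_subtype_val).mem_nhds (hc x))

/-- The chart of `S` extends to an open set of `N`; following the extension by the inverse chart
gives the retraction. -/
theorem exists_retraction (x : S) :
    letI := chartedSpace c hc
    ∃ V : Set N, IsOpen V ∧ (x : N) ∈ V ∧ ∃ r : N → S, ContMDiffOn I (𝓡 k) ∞ r V ∧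
      ∀ y : S, (y : N) ∈ V → r y = y := by
  let _ := chartedSpace c hc
  have := isManifold c hc
  refine ⟨(c x).source ∩ (c x).toFun ⁻¹' (c x).target,
    (c x).smooth_toFun.continuousOn.isOpen_inter_preimage (c x).isOpen_source (c x).isOpen_target,
    ⟨hc x, (c x).mapsTo ⟨x.2, hc x⟩⟩, fun y => (c x).inv x ((c x).toFun y), ?_, ?_⟩
  · have h1 : ContMDiffOn (𝓡 k) (𝓡 k) ∞ ((c x).inv x) (c x).target :=
      contMDiffOn_chart_symm (I := 𝓡 k) (x := x)
    exact h1.comp ((c x).smooth_toFun.mono inter_subset_left) inter_subset_right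
  · intro y hy
    exact ((c x).toOpenPartialHomeomorph x).left_inv hy.1

end SliceChart

variable [FiniteDimensional ℝ E] {I : ModelWithCorners ℝ E H} [I.Boundaryless] [IsManifold I ∞ N]
  {F : Type*} [NormedAddCommGroup F] [NormedSpace ℝ F] [FiniteDimensional ℝ F]

/-- The zero set of a map with surjective derivative has a slice chart. -/
theorem exists_sliceChart {S : Set N} {x : N} {V : Set N} (hV : IsOpen V)
    (hxV : x ∈ V) {G : N → F} (hG : ContMDiffOn I 𝓘(ℝ, F) ∞ G V)
    (hS : ∀ y ∈ V, y ∈ S ↔ G y = 0) (hs : Function.Surjective (mfderiv I 𝓘(ℝ, F) G x))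
    {k : ℕ} (hk : Module.finrank ℝ E = Module.finrank ℝ F + k) :
    ∃ c : SliceChart I S k, x ∈ c.source := by
  set χ := extChartAt I x with hχ
  have hO : IsOpen (χ.target ∩ χ.symm ⁻¹' V) :=
    (continuousOn_extChartAt_symm x).isOpen_inter_preimage (isOpen_extChartAt_target x) hV
  have hGO : ContDiffOn ℝ ∞ (G ∘ χ.symm) (χ.target ∩ χ.symm ⁻¹' V) := by
    rw [← contMDiffOn_iff_contDiffOn]
    exact hG.comp ((contMDiffOn_extChartAt_symm x).mono inter_subset_left) inter_subset_right
  have hxs : χ.symm (χ x) = x := extChartAt_to_inv x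
  have hxO : χ x ∈ χ.target ∩ χ.symm ⁻¹' V :=
    ⟨mem_extChartAt_target x, by rw [mem_preimage, hxs]; exact hxV⟩
  have hsd : Function.Surjective (fderiv ℝ (G ∘ χ.symm) (χ x)) := by
    have h1 : MDifferentiableAt I 𝓘(ℝ, F) G x :=
      (hG.contMDiffAt (hV.mem_nhds hxV)).mdifferentiableAt (by simp)
    rw [h1.mfderiv, I.range_eq_univ, fderivWithin_univ] at hs
    exact hs
  obtain ⟨Φ, hxΦ, hΦO, hΦ, hΦ', hfst⟩ := exists_openPartialHomeomorph_fst_eq hO hGO hxO hsd hk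
  have hsrc : IsOpen (χ.source ∩ χ ⁻¹' Φ.source) :=
    (continuousOn_extChartAt x).isOpen_inter_preimage (isOpen_extChartAt_source x) Φ.open_source
  have hcont : Continuous fun y : EuclideanSpace ℝ (Fin k) => ((0 : F), y) := by fun_prop
  -- The first component of `Φ ∘ χ` is `G`, so in these coordinates `S` is the slice `{0} ×
  -- EuclideanSpace ℝ (Fin k)`, and the second component serves as its chart.
  have hzero : ∀ y, y ∈ S ∩ (χ.source ∩ χ ⁻¹' Φ.source) → Φ (χ y) = (0, (Φ (χ y)).2) := by
    rintro y ⟨hyS, hy, hy'⟩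
    refine Prod.ext ?_ rfl
    rw [hfst]
    have hyV : y ∈ V := by simpa [χ.left_inv hy] using (hΦO hy').2
    simpa [χ.left_inv hy] using (hS y hyV).1 hyS
  refine ⟨{ source := χ.source ∩ χ ⁻¹' Φ.source
            target := (fun y => ((0 : F), y)) ⁻¹' Φ.target
            toFun := fun y => (Φ (χ y)).2
            invFun := fun y => χ.symm (Φ.symm (0, y))
            isOpen_source := hsrc
            isOpen_target := Φ.open_target.preimage hcont
            smooth_toFun := ?_
            smooth_invFun := ?_
            mapsTo := ?_
            mapsTo_inv := ?_
            left_inv := ?_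
            right_inv := ?_ }, mem_extChartAt_source x, hxΦ⟩
  · have h1 : ContMDiffOn I 𝓘(ℝ, E) ∞ χ (χ.source ∩ χ ⁻¹' Φ.source) :=
      contMDiffOn_extChartAt.mono fun y hy => by simpa [hχ] using hy.1
    exact (contDiff_snd.comp_contDiffOn hΦ).contMDiffOn.comp h1 inter_subset_right
  · have h1 : ContDiffOn ℝ ∞ (fun y => Φ.symm ((0 : F), y)) ((fun y => ((0 : F), y)) ⁻¹' Φ.target) :=
      hΦ'.comp (by fun_prop) fun y hy => hy
    exact (contMDiffOn_extChartAt_symm x).comp h1.contMDiffOn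
      fun y hy => (hΦO (Φ.map_target hy)).1
  · intro y hy
    rw [mem_preimage, ← hzero y hy]
    exact Φ.map_source hy.2.2
  · intro y hy
    have h1 := Φ.map_target hy
    have h2 := hΦO h1
    refine ⟨(hS _ h2.2).2 ?_, χ.map_target h2.1, ?_⟩
    · have := hfst (Φ.symm (0, y))
      rw [Φ.right_inv hy] at this
      exact this.symm
    · rw [mem_preimage, χ.right_inv h2.1]
      exact h1
  · intro y hy
    rw [← hzero y hy, Φ.left_inv hy.2.2, χ.left_inv hy.2.1]
  · intro y hy
    rw [χ.right_inv (hΦO (Φ.map_target hy)).1, Φ.right_inv hy]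

end Slice

/-! ### Maps with local smooth retractions -/

section Retraction

variable {E : Type*} [NormedAddCommGroup E] [NormedSpace ℝ E] {H : Type*} [TopologicalSpace H]
  {N : Type*} [TopologicalSpace N] [ChartedSpace H N] {I : ModelWithCorners ℝ E H}
  {E' : Type*} [NormedAddCommGroup E'] [NormedSpace ℝ E'] {H' : Type*} [TopologicalSpace H']
  {M : Type*} [TopologicalSpace M] [ChartedSpace H' M] {J : ModelWithCorners ℝ E' H'}

/-- A smooth map `ι` such that each point of the target of the form `ι x` has a neighbourhood on
which `ι` has a smooth left inverse. -/
structure HasLocalRetractions (J : ModelWithCorners ℝ E' H') (I : ModelWithCorners ℝ E H)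
    (ι : M → N) : Prop where
  smooth : ContMDiff J I ∞ ι
  exists_retraction : ∀ x, ∃ V : Set N, IsOpen V ∧ ι x ∈ V ∧ ∃ r : N → M, ContMDiffOn I J ∞ r V ∧
    ∀ y, ι y ∈ V → r (ι y) = y

namespace HasLocalRetractions

variable {ι : M → N} (h : HasLocalRetractions J I ι)
include h

/-- A map into `M` is smooth if its composition with `ι` is. -/
theorem contMDiffOn_of_comp {E'' : Type*} [NormedAddCommGroup E''] [NormedSpace ℝ E'']
    {H'' : Type*} [TopologicalSpace H''] {C : Type*} [TopologicalSpace C] [ChartedSpace H'' C]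
    {K : ModelWithCorners ℝ E'' H''} {g : C → M} {U : Set C}
    (hg : ContMDiffOn K I ∞ (fun c => ι (g c)) U) : ContMDiffOn K J ∞ g U := by
  intro c hc
  obtain ⟨V, hV, hcV, r, hr, hrι⟩ := h.exists_retraction (g c)
  have h1 : ContMDiffWithinAt K J ∞ (fun c => r (ι (g c))) U c :=
    (hr.contMDiffAt (hV.mem_nhds hcV)).comp_contMDiffWithinAt c (hg c hc)
  refine h1.congr_of_eventuallyEq ?_ (hrι _ hcV).symm
  filter_upwards [(hg c hc).continuousWithinAt (hV.mem_nhds hcV)] with d hd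
  exact (hrι _ hd).symm

/-- This is the chain rule for `r ∘ ι`, which is the identity near `x`. -/
theorem mfderiv_retraction {V : Set N} (hV : IsOpen V) {r : N → M} (hr : ContMDiffOn I J ∞ r V)
    (hrι : ∀ y, ι y ∈ V → r (ι y) = y) {x : M} (hx : ι x ∈ V) (w : TangentSpace J x) :
    mfderiv I J r (ι x) (mfderiv J I ι x w) = w := by
  have h1 : HasMFDerivAt J I ι x (mfderiv J I ι x) :=
    ((h.smooth x).mdifferentiableAt (by simp)).hasMFDerivAt
  have h2 : HasMFDerivAt I J r (ι x) (mfderiv I J r (ι x)) :=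
    ((hr.contMDiffAt (hV.mem_nhds hx)).mdifferentiableAt (by simp)).hasMFDerivAt
  have h3 := HasMFDerivAt.comp x h2 h1
  have h4 : HasMFDerivAt J J (r ∘ ι) x (ContinuousLinearMap.id ℝ (TangentSpace J x)) := by
    refine (hasMFDerivAt_id x).congr_of_eventuallyEq ?_
    filter_upwards [(h.smooth x).continuousAt (hV.mem_nhds hx)] with y hy
    exact hrι y hy
  exact congrArg (fun L : E' →L[ℝ] E' => L w) (hasMFDerivAt_unique h3 h4)

theorem mfderiv_injective (x : M) : Function.Injective (mfderiv J I ι x) := by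
  obtain ⟨V, hV, hxV, r, hr, hrι⟩ := h.exists_retraction x
  intro w w' hw
  rw [← h.mfderiv_retraction hV hr hrι hxV w, hw, h.mfderiv_retraction hV hr hrι hxV w']

/-- A vector field `Y` restricts to a smooth vector field which is `ι`-related to `Y` wherever `Y`
is tangent to `ι`. -/
theorem exists_vectorField [FiniteDimensional ℝ E'] [IsManifold I ∞ N] [IsManifold J ∞ M]
    [SigmaCompactSpace M] [T2Space M] (Y : ∀ x : N, TangentSpace I x)
    (hY : ContMDiff I I.tangent ∞ (fun x => (⟨x, Y x⟩ : TangentBundle I N))) :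
    ∃ X : ∀ x : M, TangentSpace J x,
      ContMDiff J J.tangent ∞ (fun x => (⟨x, X x⟩ : TangentBundle J M)) ∧
      ∀ x, Y (ι x) ∈ range (mfderiv J I ι x) → mfderiv J I ι x (X x) = Y (ι x) := by
  have : IsManifold I 1 N := .of_le (n := ∞) (by simp)
  have : IsManifold J 1 M := .of_le (n := ∞) (by simp)
  -- The condition is vacuous where `Y` is not tangent. Each `t x` is thus an affine condition or no
  -- condition, hence convex, as a partition of unity requires.
  let t : ∀ x : M, Set (TangentSpace J x) := fun x =>
    {w | Y (ι x) ∈ range (mfderiv J I ι x) → mfderiv J I ι x w = Y (ι x)}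
  have hconv : ∀ x, Convex ℝ (t x) := by
    intro x w hw w' hw' a b _ _ hab hr
    rw [map_add, map_smul, map_smul, hw hr, hw' hr, ← add_smul, hab, one_smul]
  have hloc : ∀ x₀ : M, ∃ U ∈ nhds x₀, ∃ s : ∀ x : M, TangentSpace J x,
      ContMDiffOn J J.tangent ∞ (fun x => (⟨x, s x⟩ : TangentBundle J M)) U ∧
        ∀ y ∈ U, s y ∈ t y := by
    intro x
    obtain ⟨V, hV, hxV, r, hr, hrι⟩ := h.exists_retraction x
    -- The local solution is `Y` pushed forward by the retraction: if `Y (ι y)` is the image of `w`,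
    -- then the derivative of `r` returns `w`.
    refine ⟨ι ⁻¹' V, (h.smooth x).continuousAt (hV.mem_nhds hxV),
      fun y => (mfderiv I J r (ι y) (Y (ι y)) : E'), ?_, ?_⟩
    · have h1 : ContMDiffOn J J.tangent ∞
          (fun y => tangentMapWithin I J r V (⟨ι y, Y (ι y)⟩ : TangentBundle I N)) (ι ⁻¹' V) :=
        (hr.contMDiffOn_tangentMapWithin (m := ∞) (by simp) hV.uniqueMDiffOn).comp
          (hY.comp h.smooth).contMDiffOn fun y hy => hy
      refine h1.congr fun y hy => ?_
      -- The tangent map is based at `r (ι y)`, which equals `y` only propositionally.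
      have h2 : ∀ z : M, z = y → ∀ v : E', (⟨y, v⟩ : TangentBundle J M) = ⟨z, v⟩ := by
        rintro _ rfl _
        rfl
      rw [tangentMapWithin, mfderivWithin_of_isOpen hV hy]
      exact h2 _ (hrι y hy) _
    · rintro y hy ⟨w, hw⟩
      have h2 : (mfderiv I J r (ι y) (Y (ι y)) : E') = w := by
        rw [← hw]
        exact h.mfderiv_retraction hV hr hrι hy w
      exact (congrArg (fun v : E' => mfderiv J I ι y v) h2).trans hw
  obtain ⟨s, hs⟩ := exists_contMDiffSection_forall_mem_convex_of_local (n := ⊤) (F_fiber := E') J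
    (TangentSpace J : M → Type _) t hconv hloc
  exact ⟨s, s.contMDiff, hs⟩

end HasLocalRetractions

end Retraction

/-! ### Fiber products of manifolds -/

/-- The derivative of a map of manifolds, as a map between the model spaces. -/
noncomputable def Mfd.deriv {M N : Mfd.{u}} (f : M → N) (x : M) :
    EuclideanSpace ℝ (Fin M.dim) →L[ℝ] EuclideanSpace ℝ (Fin N.dim) :=
  mfderiv (𝓡 M.dim) (𝓡 N.dim) f x

section FiberSet

variable {M₁ M₂ B : Mfd.{u}}

/-- The fiber product of two partially defined maps. -/
def fiberSet (p : M₁ → B) (D₁ : Set M₁) (f : M₂ → B) (D₂ : Set M₂) : Set (M₁ × M₂) :=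
  {x | x.1 ∈ D₁ ∧ x.2 ∈ D₂ ∧ p x.1 = f x.2}

variable {p : M₁ → B} {D₁ : Set M₁} {f : M₂ → B} {D₂ : Set M₂}

/-- In a chart `χ` of `B`, the equation `p y₁ = f y₂` becomes `χ (p y₁) - χ (f y₂) = 0`, because `χ`
is injective. `A` is the derivative of `χ`; only its invertibility matters for the kernel and the
surjectivity of the derivative of `G`. -/
theorem fiberSet_local_equation (hD₁ : IsOpen D₁) (hD₂ : IsOpen D₂)
    (hp : ContMDiffOn (𝓡 M₁.dim) (𝓡 B.dim) ∞ p D₁) (hf : ContMDiffOn (𝓡 M₂.dim) (𝓡 B.dim) ∞ f D₂)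
    {x : M₁ × M₂} (hx : x ∈ fiberSet p D₁ f D₂) :
    ∃ V : Set (M₁ × M₂), IsOpen V ∧ x ∈ V ∧ ∃ G : M₁ × M₂ → EuclideanSpace ℝ (Fin B.dim),
      ContMDiffOn ((𝓡 M₁.dim).prod (𝓡 M₂.dim)) (𝓡 B.dim) ∞ G V ∧
      (∀ y ∈ V, y ∈ fiberSet p D₁ f D₂ ↔ G y = 0) ∧
      ∃ A : EuclideanSpace ℝ (Fin B.dim) ≃L[ℝ] EuclideanSpace ℝ (Fin B.dim),
        ∀ v : EuclideanSpace ℝ (Fin M₁.dim) × EuclideanSpace ℝ (Fin M₂.dim),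
          (mfderiv ((𝓡 M₁.dim).prod (𝓡 M₂.dim)) (𝓡 B.dim) G x v : EuclideanSpace ℝ (Fin B.dim)) =
            A (Mfd.deriv p x.1 v.1 -
              Mfd.deriv f x.2 v.2) := by
  obtain ⟨h₁, h₂, hpf⟩ := hx
  have : IsManifold (𝓡 B.dim) 1 B := .of_le (n := ∞) (by simp)
  set χ := extChartAt (𝓡 B.dim) (p x.1) with hχ
  have hsrc : IsOpen χ.source := isOpen_extChartAt_source _
  have hV₁ : IsOpen (D₁ ∩ p ⁻¹' χ.source) := hp.continuousOn.isOpen_inter_preimage hD₁ hsrc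
  have hV₂ : IsOpen (D₂ ∩ f ⁻¹' χ.source) := hf.continuousOn.isOpen_inter_preimage hD₂ hsrc
  have hxs : p x.1 ∈ χ.source := mem_extChartAt_source _
  have hχs : ContMDiffOn (𝓡 B.dim) (𝓡 B.dim) ∞ χ χ.source := by
    rw [hχ, extChartAt_source]
    exact contMDiffOn_extChartAt
  have hG₁ : ContMDiffOn ((𝓡 M₁.dim).prod (𝓡 M₂.dim)) (𝓡 B.dim) ∞ (fun y : M₁ × M₂ => χ (p y.1))
      ((D₁ ∩ p ⁻¹' χ.source) ×ˢ (D₂ ∩ f ⁻¹' χ.source)) :=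
    hχs.comp (hp.comp contMDiffOn_fst fun y hy => hy.1.1) fun y hy => hy.1.2
  have hG₂ : ContMDiffOn ((𝓡 M₁.dim).prod (𝓡 M₂.dim)) (𝓡 B.dim) ∞ (fun y : M₁ × M₂ => χ (f y.2))
      ((D₁ ∩ p ⁻¹' χ.source) ×ˢ (D₂ ∩ f ⁻¹' χ.source)) :=
    hχs.comp (hf.comp contMDiffOn_snd fun y hy => hy.2.1) fun y hy => hy.2.2
  refine ⟨_, hV₁.prod hV₂, ⟨⟨h₁, hxs⟩, h₂, by rw [mem_preimage, ← hpf]; exact hxs⟩,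
    fun y => χ (p y.1) - χ (f y.2), hG₁.sub hG₂, ?_, ?_⟩
  · rintro y ⟨⟨h1, h2⟩, h3, h4⟩
    rw [sub_eq_zero]
    exact ⟨fun h => congrArg χ h.2.2, fun h => ⟨h1, h3, χ.injOn h2 h4 h⟩⟩
  · obtain ⟨A', hA⟩ := isInvertible_mfderiv_extChartAt (I := 𝓡 B.dim) hxs
    let A : EuclideanSpace ℝ (Fin B.dim) ≃L[ℝ] EuclideanSpace ℝ (Fin B.dim) := A'
    have hχ₁ : HasMFDerivAt (𝓡 B.dim) (𝓡 B.dim) χ (p x.1)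
        (A : EuclideanSpace ℝ (Fin B.dim) →L[ℝ] EuclideanSpace ℝ (Fin B.dim)) := by
      have h := ((hχs.contMDiffAt (hsrc.mem_nhds hxs)).mdifferentiableAt (by simp)).hasMFDerivAt
      rw [← hA] at h
      exact h
    have hχ₂ : HasMFDerivAt (𝓡 B.dim) (𝓡 B.dim) χ (f x.2)
        (A : EuclideanSpace ℝ (Fin B.dim) →L[ℝ] EuclideanSpace ℝ (Fin B.dim)) := by
      rw [← hpf]
      exact hχ₁
    have hp' := ((hp.contMDiffAt (hD₁.mem_nhds h₁)).mdifferentiableAt (by simp)).hasMFDerivAt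
    have hf' := ((hf.contMDiffAt (hD₂.mem_nhds h₂)).mdifferentiableAt (by simp)).hasMFDerivAt
    have e₁ := HasMFDerivAt.comp x hχ₁ (HasMFDerivAt.comp x hp'
      (hasMFDerivAt_fst (I := 𝓡 M₁.dim) (I' := 𝓡 M₂.dim) x))
    have e₂ := HasMFDerivAt.comp x hχ₂ (HasMFDerivAt.comp x hf'
      (hasMFDerivAt_snd (I := 𝓡 M₁.dim) (I' := 𝓡 M₂.dim) x))
    refine ⟨A, fun v => ?_⟩
    have e := (HasMFDerivAt.sub e₁ e₂).mfderiv
    rw [map_sub]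
    exact congrArg (fun L : EuclideanSpace ℝ (Fin M₁.dim) × EuclideanSpace ℝ (Fin M₂.dim) →L[ℝ]
      EuclideanSpace ℝ (Fin B.dim) => L v) e

/-- The fiber product of a submersion and a smooth map is a manifold. -/
theorem exists_manifold_fiberSet (hD₁ : IsOpen D₁) (hD₂ : IsOpen D₂)
    (hp : ContMDiffOn (𝓡 M₁.dim) (𝓡 B.dim) ∞ p D₁) (hf : ContMDiffOn (𝓡 M₂.dim) (𝓡 B.dim) ∞ f D₂)
    (hs : ∀ x ∈ D₁, Function.Surjective (Mfd.deriv p x))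
    (hne : (fiberSet p D₁ f D₂).Nonempty) :
    ∃ (P : Mfd.{u}) (ι : P → M₁ × M₂), range ι = fiberSet p D₁ f D₂ ∧ Function.Injective ι ∧
      HasLocalRetractions (𝓡 P.dim) ((𝓡 M₁.dim).prod (𝓡 M₂.dim)) ι ∧
      ∀ (x : P) (v : EuclideanSpace ℝ (Fin M₁.dim) × EuclideanSpace ℝ (Fin M₂.dim)),
        Mfd.deriv p (ι x).1 v.1 =
          Mfd.deriv f (ι x).2 v.2 →
        v ∈ range (mfderiv (𝓡 P.dim) ((𝓡 M₁.dim).prod (𝓡 M₂.dim)) ι x) := by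
  set S := fiberSet p D₁ f D₂ with hS
  -- A point of the fiber set gives a surjective derivative, hence `B.dim ≤ M₁.dim`; without a point
  -- the dimension `k` might not exist.
  obtain ⟨k, hk⟩ : ∃ k, M₁.dim + M₂.dim = B.dim + k := by
    obtain ⟨x, hx⟩ := hne
    have h : Module.finrank ℝ (EuclideanSpace ℝ (Fin B.dim)) ≤
        Module.finrank ℝ (EuclideanSpace ℝ (Fin M₁.dim)) :=
      LinearMap.finrank_le_finrank_of_surjective
        (f := (Mfd.deriv p x.1).toLinearMap) (hs _ hx.1)
    rw [finrank_euclideanSpace_fin, finrank_euclideanSpace_fin] at h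
    exact ⟨M₁.dim + M₂.dim - B.dim, by omega⟩
  have hk' : Module.finrank ℝ (EuclideanSpace ℝ (Fin M₁.dim) × EuclideanSpace ℝ (Fin M₂.dim)) =
      Module.finrank ℝ (EuclideanSpace ℝ (Fin B.dim)) + k := by simpa using hk
  have hsurj : ∀ {x} (_ : x ∈ S) {A : EuclideanSpace ℝ (Fin B.dim) ≃L[ℝ]
      EuclideanSpace ℝ (Fin B.dim)} {L : EuclideanSpace ℝ (Fin M₁.dim) ×
      EuclideanSpace ℝ (Fin M₂.dim) →L[ℝ] EuclideanSpace ℝ (Fin B.dim)},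
      (∀ v, L v = A (Mfd.deriv p x.1 v.1 -
        Mfd.deriv f x.2 v.2)) →
      Function.Surjective L := by
    intro x hx A L hL w
    obtain ⟨v, hv⟩ := hs x.1 hx.1 (A.symm w)
    refine ⟨(v, 0), ?_⟩
    rw [hL]
    have h0 : Mfd.deriv f x.2 (0 : EuclideanSpace ℝ (Fin M₂.dim)) = 0 := map_zero _
    change A (Mfd.deriv p x.1 v -
      Mfd.deriv f x.2 (0 : EuclideanSpace ℝ (Fin M₂.dim))) = w
    rw [h0, sub_zero]
    exact (congrArg A hv).trans (A.apply_symm_apply w)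
  have hc : ∀ x : S, ∃ c : SliceChart ((𝓡 M₁.dim).prod (𝓡 M₂.dim)) S k, (x : M₁ × M₂) ∈ c.source := by
    intro x
    obtain ⟨V, hV, hxV, G, hG, hGS, A, hA⟩ := fiberSet_local_equation hD₁ hD₂ hp hf x.2
    exact exists_sliceChart hV hxV hG hGS (hsurj x.2 hA) hk'
  choose c hc using hc
  let _ := SliceChart.chartedSpace c hc
  have := SliceChart.isManifold c hc
  have hι : HasLocalRetractions (𝓡 k) ((𝓡 M₁.dim).prod (𝓡 M₂.dim)) ((↑) : S → M₁ × M₂) :=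
    ⟨SliceChart.contMDiff_subtype_val c hc, SliceChart.exists_retraction c hc⟩
  refine ⟨{ carrier := S, dim := k }, Subtype.val, Subtype.range_coe, Subtype.val_injective, hι, ?_⟩
  intro x v hv
  obtain ⟨V, hV, hxV, G, hG, hGS, A, hA⟩ := fiberSet_local_equation hD₁ hD₂ hp hf x.2
  let L : EuclideanSpace ℝ (Fin M₁.dim) × EuclideanSpace ℝ (Fin M₂.dim) →L[ℝ]
    EuclideanSpace ℝ (Fin B.dim) := mfderiv ((𝓡 M₁.dim).prod (𝓡 M₂.dim)) (𝓡 B.dim) G x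
  let T : EuclideanSpace ℝ (Fin k) →L[ℝ] EuclideanSpace ℝ (Fin M₁.dim) ×
    EuclideanSpace ℝ (Fin M₂.dim) :=
    mfderiv (𝓡 k) ((𝓡 M₁.dim).prod (𝓡 M₂.dim)) ((↑) : S → M₁ × M₂) x
  have hLT : ∀ w, L (T w) = 0 := by
    intro w
    have h1 := HasMFDerivAt.comp x
      ((hG.contMDiffAt (hV.mem_nhds hxV)).mdifferentiableAt (by simp)).hasMFDerivAt
      ((hι.smooth x).mdifferentiableAt (by simp)).hasMFDerivAt
    have h2 : HasMFDerivAt (𝓡 k) (𝓡 B.dim) (G ∘ ((↑) : S → M₁ × M₂)) x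
        (0 : EuclideanSpace ℝ (Fin k) →L[ℝ] EuclideanSpace ℝ (Fin B.dim)) := by
      refine (hasMFDerivAt_const (0 : EuclideanSpace ℝ (Fin B.dim)) x).congr_of_eventuallyEq ?_
      filter_upwards [(hι.smooth x).continuousAt (hV.mem_nhds hxV)] with y hy
      exact (hGS _ hy).1 y.2
    exact congrArg (fun L : EuclideanSpace ℝ (Fin k) →L[ℝ] EuclideanSpace ℝ (Fin B.dim) => L w)
      (hasMFDerivAt_unique h1 h2)
  -- The range of `T` lies in the kernel of `L`. Both have dimension `k`, as `T` is injective and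
  -- `L` surjective, so they coincide; the kernel of `L` is given by `Tp v₁ = Tf v₂`.
  have hle : T.toLinearMap.range ≤ L.toLinearMap.ker := by
    rintro _ ⟨w, rfl⟩
    exact hLT w
  have hT : T.toLinearMap.ker = ⊥ := LinearMap.ker_eq_bot.2 (hι.mfderiv_injective x)
  have hL : L.toLinearMap.range = ⊤ := LinearMap.range_eq_top.2 (hsurj x.2 hA)
  have h1 := T.toLinearMap.finrank_range_add_finrank_ker
  have h2 := L.toLinearMap.finrank_range_add_finrank_ker
  rw [hT, finrank_bot, finrank_euclideanSpace_fin] at h1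
  rw [hL, finrank_top, hk'] at h2
  have heq := Submodule.eq_of_le_of_finrank_eq hle (by omega)
  have hmem : v ∈ L.toLinearMap.ker := by
    refine (hA v).trans ?_
    rw [hv, sub_self, map_zero]
  rw [← heq] at hmem
  exact hmem

end FiberSet

/-! ### Fiber products of smooth sets with vector fields -/

theorem Mfd.deriv_congr {M N : Mfd.{u}} {f g : M → N} {U : Set M} (hU : IsOpen U)
    (h : EqOn f g U) {x : M} (hx : x ∈ U) : Mfd.deriv f x = Mfd.deriv g x :=
  Filter.EventuallyEq.mfderiv_eq (Filter.eventuallyEq_of_mem (hU.mem_nhds hx) h)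

/-- Restriction of the domain of a representative. -/
def SmoothRep.restrictDom {A B : SmoothSet.{u}} (f : SmoothRep A B) (U : Set A.ambient)
    (hU : IsOpen U) (hAU : A.carrier ⊆ U) (hUf : U ⊆ f.dom) : SmoothRep A B where
  dom := U
  isOpen_dom := hU
  subset_dom := hAU
  toFun := f.toFun
  smooth := f.smooth.mono hUf
  mapsTo := f.mapsTo

/-- Values and derivatives near `S` depend only on the germ. The equation can therefore be tested on
any given representative, after shrinking its domain around `S`. -/
theorem SmoothMap.isSemiconjugacy_restrict_iff {A B : SmoothSet.{u}} (f : SmoothRep A B)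
    (X : VectorField A.ambient) (Y : VectorField B.ambient) (S : Set A.ambient)
    (hS : S ⊆ A.carrier) :
    (SmoothMap.restrict (Quotient.mk _ f) S hS).IsSemiconjugacy X Y ↔
      ∃ U : Set A.ambient, IsOpen U ∧ S ⊆ U ∧ U ⊆ f.dom ∧
        ∀ x ∈ U, Mfd.deriv f.toFun x (X.toFun x) = Y.toFun (f.toFun x) := by
  constructor
  · rintro ⟨g, hg, hgX⟩
    obtain ⟨U, hU, hSU, hUd, hUe⟩ := Quotient.exact hg
    refine ⟨U, hU, hSU, fun x hx => (hUd hx).2, fun x hx => ?_⟩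
    have h1 : Mfd.deriv g.toFun x = Mfd.deriv f.toFun x := Mfd.deriv_congr hU hUe hx
    have h2 : g.toFun x = f.toFun x := hUe hx
    rw [← h1, ← h2]
    exact hgX x (hUd hx).1
  · rintro ⟨U, hU, hSU, hUd, hX⟩
    exact ⟨(f.restrict S hS).restrictDom U hU hSU hUd,
      Quotient.sound ⟨U, hU, hSU, fun x hx => ⟨hx, hUd hx⟩, fun _ _ => rfl⟩, hX⟩

/-- A fiber product of two smooth maps whose targets `B i₁` and `B i₂` belong to one family, with a
vector field on it.  The equations of the square are equations in sigma types, and contain the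
equation `i₁ = i₂`. -/
structure FiberProduct {J : Type u} (B : J → SmoothSet.{u}) {A₁ A₂ : SmoothSet.{u}} {i₁ i₂ : J}
    (α : SmoothMap A₁ (B i₁)) (β : SmoothMap A₂ (B i₂)) (X₁ : VectorField A₁.ambient)
    (X₂ : VectorField A₂.ambient) (F₁ : Set A₁.ambient) (F₂ : Set A₂.ambient) where
  obj : SmoothSet.{u}
  field : VectorField obj.ambient
  fst : SmoothMap obj A₁
  snd : SmoothMap obj A₂
  condition : (⟨i₁, fst.comp α⟩ : Σ i, SmoothMap obj (B i)) = ⟨i₂, snd.comp β⟩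
  exists_point : ∀ x₁ x₂, (⟨i₁, α.apply x₁⟩ : Σ i, (B i).carrier) = ⟨i₂, β.apply x₂⟩ →
    ∃ x, fst.apply x = x₁ ∧ snd.apply x = x₂
  point_ext : ∀ x y, fst.apply x = fst.apply y → snd.apply x = snd.apply y → x = y
  exists_lift : ∀ (C : SmoothSet.{u}) (γ₁ : SmoothMap C A₁) (γ₂ : SmoothMap C A₂),
    (⟨i₁, γ₁.comp α⟩ : Σ i, SmoothMap C (B i)) = ⟨i₂, γ₂.comp β⟩ →
    ∃ γ : SmoothMap C obj, γ.comp fst = γ₁ ∧ γ.comp snd = γ₂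
  hom_ext : ∀ (C : SmoothSet.{u}) (γ γ' : SmoothMap C obj), γ.comp fst = γ'.comp fst →
    γ.comp snd = γ'.comp snd → γ = γ'
  semiconj : ∀ (S : Set obj.ambient) (hS : S ⊆ obj.carrier),
    (∀ x : obj.carrier, (x : obj.ambient) ∈ S →
      (fst.apply x : A₁.ambient) ∈ F₁ ∧ (snd.apply x : A₂.ambient) ∈ F₂) →
    (fst.restrict S hS).IsSemiconjugacy field X₁ ∧ (snd.restrict S hS).IsSemiconjugacy field X₂
  lift_semiconj : ∀ (C : SmoothSet.{u}) (γ : SmoothMap C obj) (W : VectorField C.ambient)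
    (T : Set C.ambient) (hT : T ⊆ C.carrier),
    (∀ x : C.carrier, (x : C.ambient) ∈ T →
      (fst.apply (γ.apply x) : A₁.ambient) ∈ F₁ ∧ (snd.apply (γ.apply x) : A₂.ambient) ∈ F₂) →
    ((γ.comp fst).restrict T hT).IsSemiconjugacy W X₁ →
    ((γ.comp snd).restrict T hT).IsSemiconjugacy W X₂ →
    (γ.restrict T hT).IsSemiconjugacy W field

/-- The product of two vector fields. -/
def VectorField.prod {M₁ M₂ : Mfd.{u}} (X₁ : VectorField M₁) (X₂ : VectorField M₂)
    (x : M₁ × M₂) : TangentSpace ((𝓡 M₁.dim).prod (𝓡 M₂.dim)) x :=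
  ((X₁.toFun x.1, X₂.toFun x.2) : EuclideanSpace ℝ (Fin M₁.dim) × EuclideanSpace ℝ (Fin M₂.dim))

theorem VectorField.contMDiff_prod {M₁ M₂ : Mfd.{u}} (X₁ : VectorField M₁) (X₂ : VectorField M₂) :
    ContMDiff ((𝓡 M₁.dim).prod (𝓡 M₂.dim)) ((𝓡 M₁.dim).prod (𝓡 M₂.dim)).tangent ∞
      (fun x => (⟨x, X₁.prod X₂ x⟩ :
        TangentBundle ((𝓡 M₁.dim).prod (𝓡 M₂.dim)) (M₁ × M₂))) := by
  have : IsManifold (𝓡 M₁.dim) 1 M₁ := .of_le (n := ∞) (by simp)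
  have : IsManifold (𝓡 M₂.dim) 1 M₂ := .of_le (n := ∞) (by simp)
  exact contMDiff_equivTangentBundleProd_symm.comp
    ((X₁.smooth.comp contMDiff_fst).prodMk (X₂.smooth.comp contMDiff_snd))

/-- Needed for the partition of unity behind `exists_vectorField`. -/
instance Mfd.sigmaCompactSpace (M : Mfd.{u}) : SigmaCompactSpace M :=
  have := Manifold.locallyCompact_of_finiteDimensional (M := M) (𝓡 M.dim)
  inferInstance

/-! ### Existence of the fiber product of two smooth sets -/

section Existence

variable {J : Type u} {B : J → SmoothSet.{u}} {A₁ A₂ : SmoothSet.{u}}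

/-- The ambient manifold is the fiber manifold of the two representatives over their whole domains,
and the smooth set is its part over `A₁ × A₂`. The field comes from `X₁ × X₂` and is controlled only
over `U₁ × U₂`, which suffices near `F₁ × F₂`. -/
theorem nonempty_fiberProduct_of_rep {i : J} (p : SmoothRep A₁ (B i))
    (hp : ∀ x ∈ p.dom, Function.Surjective (Mfd.deriv p.toFun x)) (f : SmoothRep A₂ (B i))
    (X₁ : VectorField A₁.ambient) (X₂ : VectorField A₂.ambient) (Y : VectorField (B i).ambient)
    (F₁ : Set A₁.ambient) (F₂ : Set A₂.ambient) {U₁ : Set A₁.ambient} (hU₁ : IsOpen U₁)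
    (hFU₁ : F₁ ⊆ U₁) (hpY : ∀ x ∈ U₁, Mfd.deriv p.toFun x (X₁.toFun x) = Y.toFun (p.toFun x))
    {U₂ : Set A₂.ambient} (hU₂ : IsOpen U₂) (hFU₂ : F₂ ⊆ U₂)
    (hfY : ∀ x ∈ U₂, Mfd.deriv f.toFun x (X₂.toFun x) = Y.toFun (f.toFun x))
    (hne : ∃ x₁ ∈ A₁.carrier, ∃ x₂ ∈ A₂.carrier, p.toFun x₁ = f.toFun x₂) :
    Nonempty (FiberProduct B (Quotient.mk _ p : SmoothMap A₁ (B i))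
      (Quotient.mk _ f : SmoothMap A₂ (B i)) X₁ X₂ F₁ F₂) := by
  obtain ⟨P, ι, hrange, hinj, hι, htan⟩ := exists_manifold_fiberSet p.isOpen_dom f.isOpen_dom
    p.smooth f.smooth hp (by
      obtain ⟨x₁, h₁, x₂, h₂, h⟩ := hne
      exact ⟨(x₁, x₂), p.subset_dom h₁, f.subset_dom h₂, h⟩)
  have hmem : ∀ x, (ι x).1 ∈ p.dom ∧ (ι x).2 ∈ f.dom ∧ p.toFun (ι x).1 = f.toFun (ι x).2 :=
    fun x => by
      have h : ι x ∈ fiberSet p.toFun p.dom f.toFun f.dom := hrange ▸ mem_range_self x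
      exact h
  have hex : ∀ x₁ ∈ p.dom, ∀ x₂ ∈ f.dom, p.toFun x₁ = f.toFun x₂ → ∃ x, ι x = (x₁, x₂) :=
    fun x₁ h₁ x₂ h₂ h => by
      have h : (x₁, x₂) ∈ range ι := hrange ▸ (⟨h₁, h₂, h⟩ : (x₁, x₂) ∈ fiberSet _ _ _ _)
      exact h
  obtain ⟨Z, hZ, hZι⟩ := hι.exists_vectorField _ (X₁.contMDiff_prod X₂)
  -- Here `X₁ × X₂` is tangent to the fiber manifold: `Tp X₁ = Y ∘ p = Y ∘ f = Tf X₂` at its points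
  -- over `U₁ × U₂`.
  have hZt : ∀ x, (ι x).1 ∈ U₁ → (ι x).2 ∈ U₂ →
      mfderiv (𝓡 P.dim) ((𝓡 A₁.ambient.dim).prod (𝓡 A₂.ambient.dim)) ι x (Z x) =
        X₁.prod X₂ (ι x) := by
    intro x h₁ h₂
    refine hZι x (htan x _ ?_)
    refine (hpY _ h₁).trans (.trans ?_ (hfY _ h₂).symm)
    rw [(hmem x).2.2]
  have hιc : Continuous ι := hι.smooth.continuous
  let P' : SmoothSet.{u} := ⟨P, {x | (ι x).1 ∈ A₁.carrier ∧ (ι x).2 ∈ A₂.carrier}⟩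
  let q₁ : SmoothRep P' A₁ :=
    { dom := univ
      isOpen_dom := isOpen_univ
      subset_dom := subset_univ _
      toFun := fun x => (ι x).1
      smooth := (contMDiff_fst.comp hι.smooth).contMDiffOn
      mapsTo := fun x hx => hx.1 }
  let q₂ : SmoothRep P' A₂ :=
    { dom := univ
      isOpen_dom := isOpen_univ
      subset_dom := subset_univ _
      toFun := fun x => (ι x).2
      smooth := (contMDiff_snd.comp hι.smooth).contMDiffOn
      mapsTo := fun x hx => hx.2 }
  have hpair : ∀ {M : Mfd.{u}} {g : M → P} {c : M}, MDifferentiableAt (𝓡 M.dim) (𝓡 P.dim) g c →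
      ∀ w : EuclideanSpace ℝ (Fin M.dim),
        (mfderiv (𝓡 P.dim) ((𝓡 A₁.ambient.dim).prod (𝓡 A₂.ambient.dim)) ι (g c)
          (Mfd.deriv g c w) : EuclideanSpace ℝ (Fin A₁.ambient.dim) ×
            EuclideanSpace ℝ (Fin A₂.ambient.dim)) =
        (Mfd.deriv (fun c => (ι (g c)).1) c w, Mfd.deriv (fun c => (ι (g c)).2) c w) := by
    intro M g c hg w
    have h := HasMFDerivAt.comp c ((hι.smooth (g c)).mdifferentiableAt (by simp)).hasMFDerivAt
      hg.hasMFDerivAt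
    have h₁ := (HasMFDerivAt.comp c (hasMFDerivAt_fst (I := 𝓡 A₁.ambient.dim)
      (I' := 𝓡 A₂.ambient.dim) (ι (g c))) h).mfderiv
    have h₂ := (HasMFDerivAt.comp c (hasMFDerivAt_snd (I := 𝓡 A₁.ambient.dim)
      (I' := 𝓡 A₂.ambient.dim) (ι (g c))) h).mfderiv
    exact Prod.ext
      (congrArg (fun L : EuclideanSpace ℝ (Fin M.dim) →L[ℝ]
        EuclideanSpace ℝ (Fin A₁.ambient.dim) => L w) h₁).symm
      (congrArg (fun L : EuclideanSpace ℝ (Fin M.dim) →L[ℝ]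
        EuclideanSpace ℝ (Fin A₂.ambient.dim) => L w) h₂).symm
  have hid : ∀ (x : P) (w : EuclideanSpace ℝ (Fin P.dim)),
      (mfderiv (𝓡 P.dim) ((𝓡 A₁.ambient.dim).prod (𝓡 A₂.ambient.dim)) ι x w :
          EuclideanSpace ℝ (Fin A₁.ambient.dim) × EuclideanSpace ℝ (Fin A₂.ambient.dim)) =
        (Mfd.deriv q₁.toFun x w, Mfd.deriv q₂.toFun x w) := by
    intro x w
    have h := hpair (g := fun x : P => x) (c := x) mdifferentiableAt_id w
    have h' : Mfd.deriv (fun x : P => x) x = ContinuousLinearMap.id ℝ _ := mfderiv_id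
    rw [h'] at h
    exact h
  have hW : IsOpen {x : P | (ι x).1 ∈ U₁ ∧ (ι x).2 ∈ U₂} := (hU₁.prod hU₂).preimage hιc
  refine ⟨{ obj := P'
            field := ⟨Z, hZ⟩
            fst := Quotient.mk _ q₁
            snd := Quotient.mk _ q₂
            condition := ?_
            exists_point := ?_
            point_ext := ?_
            exists_lift := ?_
            hom_ext := ?_
            semiconj := ?_
            lift_semiconj := ?_ }⟩
  · refine congrArg (Sigma.mk i) (Quotient.sound ⟨univ, isOpen_univ, subset_univ _, ?_, ?_⟩)
    · exact fun x _ => ⟨⟨trivial, (hmem x).1⟩, trivial, (hmem x).2.1⟩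
    · exact fun x _ => (hmem x).2.2
  · intro x₁ x₂ h
    have h' : p.toFun x₁ = f.toFun x₂ := congrArg Subtype.val (eq_of_heq (Sigma.mk.inj h).2)
    obtain ⟨x, hx⟩ := hex x₁ (p.subset_dom x₁.2) x₂ (f.subset_dom x₂.2) h'
    refine ⟨⟨x, ?_⟩, Subtype.ext (congrArg Prod.fst hx), Subtype.ext (congrArg Prod.snd hx)⟩
    change (ι x).1 ∈ A₁.carrier ∧ (ι x).2 ∈ A₂.carrier
    rw [hx]
    exact ⟨x₁.2, x₂.2⟩
  · intro x y h₁ h₂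
    exact Subtype.ext (hinj (Prod.ext (congrArg Subtype.val h₁) (congrArg Subtype.val h₂)))
  · intro C γ₁ γ₂ h
    induction γ₁ using Quotient.inductionOn with
    | h g₁ => induction γ₂ using Quotient.inductionOn with
      | h g₂ =>
        obtain ⟨U, hU, hCU, hUd, hUe⟩ : SmoothRep.GermEquiv (g₁.comp p) (g₂.comp f) :=
          Quotient.exact (eq_of_heq (Sigma.mk.inj h).2)
        obtain ⟨x₀⟩ : Nonempty P := by
          obtain ⟨x₁, h₁, x₂, h₂, h⟩ := hne
          exact ⟨(hex x₁ (p.subset_dom h₁) x₂ (f.subset_dom h₂) h).choose⟩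
        -- The lift is chosen pointwise on `U`, with the default `x₀` elsewhere. Its smoothness
        -- comes from that of `ι ∘ g`, through the local retractions.
        have hg : ∀ c, ∃ x, c ∈ U → ι x = (g₁.toFun c, g₂.toFun c) := by
          intro c
          by_cases hc : c ∈ U
          · obtain ⟨x, hx⟩ := hex _ (hUd hc).1.2 _ (hUd hc).2.2 (hUe hc)
            exact ⟨x, fun _ => hx⟩
          · exact ⟨x₀, fun h => absurd h hc⟩
        choose g hg using hg
        have hgs : ContMDiffOn (𝓡 C.ambient.dim) (𝓡 P.dim) ∞ g U := by
          refine hι.contMDiffOn_of_comp (ContMDiffOn.congr ?_ hg)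
          exact (g₁.smooth.mono fun c hc => (hUd hc).1.1).prodMk
            (g₂.smooth.mono fun c hc => (hUd hc).2.1)
        let γ : SmoothRep C P' :=
          { dom := U
            isOpen_dom := hU
            subset_dom := hCU
            toFun := g
            smooth := hgs
            mapsTo := fun c hc => by
              change (ι (g c)).1 ∈ A₁.carrier ∧ (ι (g c)).2 ∈ A₂.carrier
              rw [hg c (hCU hc)]
              exact ⟨g₁.mapsTo hc, g₂.mapsTo hc⟩ }
        exact ⟨Quotient.mk _ γ,
          Quotient.sound ⟨U, hU, hCU, fun c hc => ⟨⟨hc, trivial⟩, (hUd hc).1.1⟩,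
            fun c hc => congrArg Prod.fst (hg c hc)⟩,
          Quotient.sound ⟨U, hU, hCU, fun c hc => ⟨⟨hc, trivial⟩, (hUd hc).2.1⟩,
            fun c hc => congrArg Prod.snd (hg c hc)⟩⟩
  · intro C γ γ' h₁ h₂
    induction γ using Quotient.inductionOn with
    | h g => induction γ' using Quotient.inductionOn with
      | h g' =>
        obtain ⟨U, hU, hCU, hUd, hUe⟩ : SmoothRep.GermEquiv (g.comp q₁) (g'.comp q₁) :=
          Quotient.exact h₁
        obtain ⟨U', hU', hCU', -, hUe'⟩ : SmoothRep.GermEquiv (g.comp q₂) (g'.comp q₂) :=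
          Quotient.exact h₂
        exact Quotient.sound ⟨U ∩ U', hU.inter hU', subset_inter hCU hCU',
          fun c hc => ⟨(hUd hc.1).1.1, (hUd hc.1).2.1⟩,
          fun c hc => hinj (Prod.ext (hUe hc.1) (hUe' hc.2))⟩
  · intro S hS hSF
    have hSW : S ⊆ {x : P | (ι x).1 ∈ U₁ ∧ (ι x).2 ∈ U₂} := fun x hx =>
      ⟨hFU₁ (hSF ⟨x, hS hx⟩ hx).1, hFU₂ (hSF ⟨x, hS hx⟩ hx).2⟩
    constructor
    · rw [SmoothMap.isSemiconjugacy_restrict_iff]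
      exact ⟨_, hW, hSW, subset_univ _, fun x hx =>
        congrArg Prod.fst ((hid x (Z x)).symm.trans (hZt x hx.1 hx.2))⟩
    · rw [SmoothMap.isSemiconjugacy_restrict_iff]
      exact ⟨_, hW, hSW, subset_univ _, fun x hx =>
        congrArg Prod.snd ((hid x (Z x)).symm.trans (hZt x hx.1 hx.2))⟩
  · intro C γ W T hT hTF h₁ h₂
    induction γ using Quotient.inductionOn with
    | h g =>
      obtain ⟨V₁, hV₁, hTV₁, hV₁d, hV₁e⟩ :=
        (SmoothMap.isSemiconjugacy_restrict_iff (g.comp q₁) _ _ _ _).1 h₁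
      obtain ⟨V₂, hV₂, hTV₂, -, hV₂e⟩ :=
        (SmoothMap.isSemiconjugacy_restrict_iff (g.comp q₂) _ _ _ _).1 h₂
      rw [SmoothMap.isSemiconjugacy_restrict_iff]
      refine ⟨(V₁ ∩ V₂) ∩ (g.dom ∩ g.toFun ⁻¹' {x : P | (ι x).1 ∈ U₁ ∧ (ι x).2 ∈ U₂}),
        (hV₁.inter hV₂).inter (g.smooth.continuousOn.isOpen_inter_preimage g.isOpen_dom hW), ?_,
        fun c hc => hc.2.1, ?_⟩
      · exact fun c hc => ⟨⟨hTV₁ hc, hTV₂ hc⟩, g.subset_dom (hT hc),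
          hFU₁ (hTF ⟨c, hT hc⟩ hc).1, hFU₂ (hTF ⟨c, hT hc⟩ hc).2⟩
      · rintro c ⟨⟨hc₁, hc₂⟩, hcd, hcU₁, hcU₂⟩
        have hgc : MDifferentiableAt (𝓡 C.ambient.dim) (𝓡 P.dim) g.toFun c :=
          (g.smooth.contMDiffAt (g.isOpen_dom.mem_nhds hcd)).mdifferentiableAt (by simp)
        -- The derivative of `ι` is injective, so the semiconjugacy equation may be checked after
        -- applying it, where it splits into the equations of the two projections.
        exact hι.mfderiv_injective (g.toFun c) <| (hpair hgc (W.toFun c)).trans <|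
          (Prod.ext (hV₁e c hc₁) (hV₂e c hc₂)).trans (hZt _ hcU₁ hcU₂).symm

theorem nonempty_fiberProduct {i₁ i₂ : J} (h : i₁ = i₂) {α : SmoothMap A₁ (B i₁)}
    {β : SmoothMap A₂ (B i₂)} (hα : α.IsSubmersion) (X₁ : VectorField A₁.ambient)
    (X₂ : VectorField A₂.ambient) (Y : ∀ i, VectorField (B i).ambient)
    {F₁ : Set A₁.ambient} {F₂ : Set A₂.ambient} {hF₁ : F₁ ⊆ A₁.carrier} {hF₂ : F₂ ⊆ A₂.carrier}
    (hα' : (α.restrict F₁ hF₁).IsSemiconjugacy X₁ (Y i₁))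
    (hβ : (β.restrict F₂ hF₂).IsSemiconjugacy X₂ (Y i₂))
    (hne : ∃ x₁ x₂, (⟨i₁, α.apply x₁⟩ : Σ i, (B i).carrier) = ⟨i₂, β.apply x₂⟩) :
    Nonempty (FiberProduct B α β X₁ X₂ F₁ F₂) := by
  subst h
  -- The submersive representative is fixed here; the semiconjugacy hypothesis may come with another
  -- one and is transferred to it below.
  obtain ⟨p, rfl, hp⟩ := hα
  induction β using Quotient.inductionOn with
  | h f =>
    obtain ⟨U₁, hU₁, hFU₁, -, hpY⟩ := (SmoothMap.isSemiconjugacy_restrict_iff p _ _ _ _).1 hα'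
    obtain ⟨U₂, hU₂, hFU₂, -, hfY⟩ := (SmoothMap.isSemiconjugacy_restrict_iff f _ _ _ _).1 hβ
    obtain ⟨x₁, x₂, hx⟩ := hne
    exact nonempty_fiberProduct_of_rep p hp f X₁ X₂ (Y i₁) F₁ F₂ hU₁ hFU₁ hpY hU₂ hFU₂ hfY
      ⟨x₁, x₁.2, x₂, x₂.2, congrArg Subtype.val (eq_of_heq (Sigma.mk.inj hx).2)⟩

end Existence

/-! ### Fiber products of hybrid systems -/

namespace HybridData

variable {H : HybridData.{u}} {g : H.graph.V ⊕ H.graph.E} {x y z : H.State}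

theorem Resets.src_eq (h : H.Resets g x y) : x.1 = H.graph.srcExt g := by
  cases h <;> rfl

theorem Resets.tgt_eq (h : H.Resets g x y) : y.1 = H.graph.tgtExt g := by
  cases h <;> rfl

theorem resets_inl_iff {v : H.graph.V} :
    H.Resets (Sum.inl v) x y ↔ x.1 = v ∧ x = y ∧ (x.2 : H.mode x.1) ∈ H.flow x.1 := by
  constructor
  · rintro ⟨⟩
    exact ⟨rfl, rfl, by assumption⟩
  · obtain ⟨w, x⟩ := x
    rintro ⟨rfl, rfl, h⟩
    exact .vertex _ x h

theorem resets_inr_iff {e : H.graph.E} :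
    H.Resets (Sum.inr e) x y ↔ ∃ z : H.guard e,
      x = ⟨H.graph.src e, ⟨z, H.guard_subset e z.2⟩⟩ ∧ y = ⟨H.graph.tgt e, H.reset e z⟩ := by
  constructor
  · rintro ⟨⟩
    exact ⟨_, rfl, rfl⟩
  · rintro ⟨z, rfl, rfl⟩
    exact .edge e z

/-- Inclusions of flow sets and reset maps are functions, so for fixed `g` the relation is a partial
function of the source state. -/
theorem Resets.unique (h : H.Resets g x y) (h' : H.Resets g x z) : y = z := by
  cases g with
  | inl v => exact (resets_inl_iff.1 h).2.1.symm.trans (resets_inl_iff.1 h').2.1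
  | inr e =>
    obtain ⟨a, rfl, rfl⟩ := resets_inr_iff.1 h
    obtain ⟨b, hb, rfl⟩ := resets_inr_iff.1 h'
    have hab := Subtype.mk.inj (eq_of_heq (Sigma.mk.inj hb).2)
    rw [Subtype.ext hab]

end HybridData

/-- The map of states given by a hybrid semiconjugacy. -/
abbrev Semiconj.onState {H K : HybridData.{u}} (α : Semiconj H K) (x : H.State) : K.State :=
  stateMap α.graph α.map x

theorem Semiconj.onState_comp {H K L : HybridData.{u}} (α : Semiconj H K) (β : Semiconj K L)
    (x : H.State) : (α.comp β).onState x = β.onState (α.onState x) :=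
  Sigma.ext rfl (heq_of_eq (SmoothMap.apply_comp _ _ _))

section Pullback

variable {K₁ K₂ H : HybridData.{u}} (p : Semiconj K₁ H) (f : Semiconj K₂ H)

/-- Pairs of vertices over which the fiber product of active sets is nonempty. -/
def PullbackVertex : Type u :=
  {v : K₁.graph.V × K₂.graph.V // ∃ (x₁ : K₁.active v.1) (x₂ : K₂.active v.2),
    p.onState ⟨v.1, x₁⟩ = f.onState ⟨v.2, x₂⟩}

/-- Pairs of vertices or edges, not both vertices, over which the fiber product of guard sets is
nonempty. -/
def PullbackEdge : Type u :=
  {g : (K₁.graph.V ⊕ K₁.graph.E) × (K₂.graph.V ⊕ K₂.graph.E) //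
    (∀ v₁ v₂, g ≠ (Sum.inl v₁, Sum.inl v₂)) ∧ p.graph.ext' g.1 = f.graph.ext' g.2 ∧
      ∃ x₁ y₁ x₂ y₂, K₁.Resets g.1 x₁ y₁ ∧ K₂.Resets g.2 x₂ y₂ ∧ p.onState x₁ = f.onState x₂}

variable {p f}

/-- The pair of vertices underlying a pair of states with the same image. -/
def PullbackVertex.ofState {v₁ : K₁.graph.V} {v₂ : K₂.graph.V} (h : ∃ (x₁ : K₁.State)
    (x₂ : K₂.State), x₁.1 = v₁ ∧ x₂.1 = v₂ ∧ p.onState x₁ = f.onState x₂) : PullbackVertex p f :=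
  ⟨(v₁, v₂), by
    obtain ⟨⟨_, x₁⟩, ⟨_, x₂⟩, rfl, rfl, h⟩ := h
    exact ⟨x₁, x₂, h⟩⟩

/-- Both images are resets of one state of `H` along one vertex or edge, hence equal by
`Resets.unique`. This is why resetting a pair in the fiber product stays in the fiber product. -/
theorem onState_eq_of_resets {g₁ : K₁.graph.V ⊕ K₁.graph.E} {g₂ : K₂.graph.V ⊕ K₂.graph.E}
    (hg : p.graph.ext' g₁ = f.graph.ext' g₂) {x₁ y₁ : K₁.State} {x₂ y₂ : K₂.State}
    (h₁ : K₁.Resets g₁ x₁ y₁) (h₂ : K₂.Resets g₂ x₂ y₂) (h : p.onState x₁ = f.onState x₂) :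
    p.onState y₁ = f.onState y₂ := by
  have h₁' := p.map_resets h₁
  have h₂' := f.map_resets h₂
  change H.Resets _ (p.onState x₁) (p.onState y₁) at h₁'
  change H.Resets _ (f.onState x₂) (f.onState y₂) at h₂'
  rw [← hg, ← h] at h₂'
  exact h₁'.unique h₂'

variable (p f) in
/-- The graph of the fiber product. -/
def pullbackGraph : DiGraph.{u} where
  V := PullbackVertex p f
  E := PullbackEdge p f
  src e := .ofState (v₁ := K₁.graph.srcExt e.1.1) (v₂ := K₂.graph.srcExt e.1.2) <| by
    obtain ⟨x₁, y₁, x₂, y₂, h₁, h₂, h⟩ := e.2.2.2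
    exact ⟨x₁, x₂, h₁.src_eq, h₂.src_eq, h⟩
  tgt e := .ofState (v₁ := K₁.graph.tgtExt e.1.1) (v₂ := K₂.graph.tgtExt e.1.2) <| by
    obtain ⟨x₁, y₁, x₂, y₂, h₁, h₂, h⟩ := e.2.2.2
    exact ⟨y₁, y₂, h₁.tgt_eq, h₂.tgt_eq, onState_eq_of_resets e.2.2.1 h₁ h₂ h⟩

variable (p f) in
/-- A choice of fiber products of the active sets. -/
abbrev ModeData : Type (u + 1) :=
  ∀ v : PullbackVertex p f, FiberProduct H.activeSet (p.map v.1.1) (f.map v.1.2)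
    (K₁.field v.1.1) (K₂.field v.1.2) (K₁.flow v.1.1) (K₂.flow v.1.2)

variable (D : ModeData p f)

/-- The fiber product of hybrid systems. -/
noncomputable def pullbackData : HybridData.{u} where
  graph := pullbackGraph p f
  mode v := (D v).obj.ambient
  field v := (D v).field
  active v := (D v).obj.carrier
  flow v := {m | ∃ h : m ∈ (D v).obj.carrier,
    ((D v).fst.apply ⟨m, h⟩ : K₁.mode v.1.1) ∈ K₁.flow v.1.1 ∧
    ((D v).snd.apply ⟨m, h⟩ : K₂.mode v.1.2) ∈ K₂.flow v.1.2}
  flow_subset _ _ hm := hm.1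
  -- The reset value `y` is part of the condition. Its projections are determined by `m` and they
  -- separate points, so the choice made in `reset` is forced.
  guard e := {m | ∃ (h : m ∈ (D ((pullbackGraph p f).src e)).obj.carrier)
    (y : (D ((pullbackGraph p f).tgt e)).obj.carrier),
    K₁.Resets e.1.1 ⟨_, (D _).fst.apply ⟨m, h⟩⟩ ⟨_, (D _).fst.apply y⟩ ∧
    K₂.Resets e.1.2 ⟨_, (D _).snd.apply ⟨m, h⟩⟩ ⟨_, (D _).snd.apply y⟩}
  guard_subset _ _ hm := hm.1
  reset _ z := z.2.choose_spec.choose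

/-- The first projection of the fiber product. -/
noncomputable def pullbackFst : Semiconj (pullbackData D) K₁ where
  graph :=
    { vert := fun v => v.1.1
      edge := fun e => e.1.1
      src_edge := fun _ => rfl
      tgt_edge := fun _ => rfl }
  map v := (D v).fst
  map_flow _ _ hx := hx.2.1
  map_field v := ((D v).semiconj _ _ fun _ hx => hx.2).1
  map_reset _ z := z.2.choose_spec.choose_spec.1

/-- The second projection of the fiber product. -/
noncomputable def pullbackSnd : Semiconj (pullbackData D) K₂ where
  graph :=
    { vert := fun v => v.1.2
      edge := fun e => e.1.2
      src_edge := fun _ => rfl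
      tgt_edge := fun _ => rfl }
  map v := (D v).snd
  map_flow _ _ hx := hx.2.2
  map_field v := ((D v).semiconj _ _ fun _ hx => hx.2).2
  map_reset _ z := z.2.choose_spec.choose_spec.2

theorem pullback_condition : (pullbackFst D).comp p = (pullbackSnd D).comp f :=
  Semiconj.ext_of (funext fun v => (Sigma.mk.inj (D v).condition).1) (funext fun e => e.2.2.1)
    fun v => (Sigma.mk.inj (D v).condition).2

/-! ### Joint injectivity of the projections and the universal property -/

variable {D}

theorem pullback_vertex_ext {v w : (pullbackData D).graph.V}
    (h₁ : (pullbackFst D).graph.vert v = (pullbackFst D).graph.vert w)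
    (h₂ : (pullbackSnd D).graph.vert v = (pullbackSnd D).graph.vert w) : v = w :=
  Subtype.ext (Prod.ext h₁ h₂)

theorem pullback_state_ext {x y : (pullbackData D).State}
    (h₁ : (pullbackFst D).onState x = (pullbackFst D).onState y)
    (h₂ : (pullbackSnd D).onState x = (pullbackSnd D).onState y) : x = y := by
  obtain ⟨v, x⟩ := x
  obtain ⟨w, y⟩ := y
  obtain rfl : v = w := pullback_vertex_ext (Sigma.mk.inj h₁).1 (Sigma.mk.inj h₂).1
  exact congrArg (Sigma.mk v) ((D v).point_ext x y (eq_of_heq (Sigma.mk.inj h₁).2)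
    (eq_of_heq (Sigma.mk.inj h₂).2))

/-- The mixed cases are impossible because an edge of the fiber product is never a pair of two
vertices. Without that clause each pair of vertices could appear twice, and lifts would not be
unique. -/
theorem pullback_ext'_injective {g g' : (pullbackData D).graph.V ⊕ (pullbackData D).graph.E}
    (h₁ : (pullbackFst D).graph.ext' g = (pullbackFst D).graph.ext' g')
    (h₂ : (pullbackSnd D).graph.ext' g = (pullbackSnd D).graph.ext' g') : g = g' := by
  cases g with
  | inl v => cases g' with
    | inl w => exact congrArg Sum.inl (pullback_vertex_ext (Sum.inl.inj h₁) (Sum.inl.inj h₂))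
    | inr e => exact absurd (Prod.ext h₁.symm h₂.symm) (e.2.1 _ _)
  | inr e => cases g' with
    | inl w => exact absurd (Prod.ext h₁ h₂) (e.2.1 _ _)
    | inr e' => exact congrArg Sum.inr (Subtype.ext (Prod.ext h₁ h₂))

/-- Converse to `map_resets` for the two projections jointly. On an edge, `y` witnesses that `x` is
in the guard, and the chosen reset value has the same projections as `y` by determinism. -/
theorem pullback_resets {g : (pullbackData D).graph.V ⊕ (pullbackData D).graph.E}
    {x y : (pullbackData D).State}
    (h₁ : K₁.Resets ((pullbackFst D).graph.ext' g) ((pullbackFst D).onState x)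
      ((pullbackFst D).onState y))
    (h₂ : K₂.Resets ((pullbackSnd D).graph.ext' g) ((pullbackSnd D).onState x)
      ((pullbackSnd D).onState y)) : (pullbackData D).Resets g x y := by
  cases g with
  | inl v =>
    obtain ⟨a₁, b₁, c₁⟩ := HybridData.resets_inl_iff.1 h₁
    obtain ⟨a₂, b₂, c₂⟩ := HybridData.resets_inl_iff.1 h₂
    exact HybridData.resets_inl_iff.2
      ⟨pullback_vertex_ext a₁ a₂, pullback_state_ext b₁ b₂, x.2.2, c₁, c₂⟩
  | inr e =>
    obtain ⟨v, x⟩ := x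
    obtain ⟨w, y⟩ := y
    obtain rfl : v = (pullbackData D).graph.src e := pullback_vertex_ext h₁.src_eq h₂.src_eq
    obtain rfl : w = (pullbackData D).graph.tgt e := pullback_vertex_ext h₁.tgt_eq h₂.tgt_eq
    let z : (pullbackData D).guard e := ⟨x, x.2, y, h₁, h₂⟩
    exact HybridData.resets_inr_iff.2 ⟨z, rfl, pullback_state_ext
      (h₁.unique z.2.choose_spec.choose_spec.1) (h₂.unique z.2.choose_spec.choose_spec.2)⟩

theorem pullback_hom_ext {C : HybridData.{u}} {m m' : Semiconj C (pullbackData D)}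
    (h₁ : m.comp (pullbackFst D) = m'.comp (pullbackFst D))
    (h₂ : m.comp (pullbackSnd D) = m'.comp (pullbackSnd D)) : m = m' := by
  have hv : ∀ v, m.graph.vert v = m'.graph.vert v := fun v => pullback_vertex_ext
    (congrArg (fun s => s.graph.vert v) h₁) (congrArg (fun s => s.graph.vert v) h₂)
  -- The two components have targets over vertices that are only propositionally equal; with `a` and
  -- `b` as variables the equality can be substituted.
  have key : ∀ {A : SmoothSet.{u}} {a b : PullbackVertex p f} (γ : SmoothMap A (D a).obj)
      (γ' : SmoothMap A (D b).obj), a = b →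
      HEq (γ.comp (D a).fst) (γ'.comp (D b).fst) → HEq (γ.comp (D a).snd) (γ'.comp (D b).snd) →
      HEq γ γ' := by
    rintro A a _ γ γ' rfl e₁ e₂
    exact heq_of_eq ((D a).hom_ext _ γ γ' (eq_of_heq e₁) (eq_of_heq e₂))
  refine Semiconj.ext_of (funext hv) (funext fun e => pullback_ext'_injective
    (congrArg (fun s => s.graph.edge e) h₁) (congrArg (fun s => s.graph.edge e) h₂)) fun v => ?_
  exact key (m.map v) (m'.map v) (hv v)
    (Sigma.mk.inj (congrArg (fun s : Semiconj C K₁ => (⟨s.graph.vert v, s.map v⟩ :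
      Σ w, SmoothMap (C.activeSet v) (K₁.activeSet w))) h₁)).2
    (Sigma.mk.inj (congrArg (fun s : Semiconj C K₂ => (⟨s.graph.vert v, s.map v⟩ :
      Σ w, SmoothMap (C.activeSet v) (K₂.activeSet w))) h₂)).2

theorem pullbackData_active_nonempty (v : (pullbackData D).graph.V) :
    ((pullbackData D).active v).Nonempty := by
  obtain ⟨x₁, x₂, h⟩ := v.2
  obtain ⟨x, -⟩ := (D v).exists_point x₁ x₂ h
  exact ⟨x.1, x.2⟩

/-- The states recorded in a `PullbackEdge` provide a point over the two guards, and their resets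
provide the reset value. -/
theorem pullbackData_guard_nonempty (e : (pullbackData D).graph.E) :
    ((pullbackData D).guard e).Nonempty := by
  obtain ⟨⟨v₁, x₁⟩, ⟨w₁, y₁⟩, ⟨v₂, x₂⟩, ⟨w₂, y₂⟩, h₁, h₂, h⟩ := e.2.2.2
  have h' := onState_eq_of_resets e.2.2.1 h₁ h₂ h
  obtain rfl : v₁ = ((pullbackData D).graph.src e).1.1 := h₁.src_eq
  obtain rfl : v₂ = ((pullbackData D).graph.src e).1.2 := h₂.src_eq
  obtain rfl : w₁ = ((pullbackData D).graph.tgt e).1.1 := h₁.tgt_eq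
  obtain rfl : w₂ = ((pullbackData D).graph.tgt e).1.2 := h₂.tgt_eq
  obtain ⟨x, rfl, rfl⟩ := (D ((pullbackData D).graph.src e)).exists_point x₁ x₂ h
  obtain ⟨y, rfl, rfl⟩ := (D ((pullbackData D).graph.tgt e)).exists_point y₁ y₂ h'
  exact ⟨x.1, x.2, y, h₁, h₂⟩

variable (D) in
-- Points of the active sets and guards of `C` show that the pairs of image vertices and edges
-- belong to the graph of the fiber product. The components lift mode by mode, and compatibility
-- with resets is checked on the two projections.
theorem exists_pullback_lift {C : HybridData.{u}} (hC : ∀ v, (C.active v).Nonempty)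
    (hCe : ∀ e, (C.guard e).Nonempty) (q₁ : Semiconj C K₁) (q₂ : Semiconj C K₂)
    (h : q₁.comp p = q₂.comp f) :
    ∃ m : Semiconj C (pullbackData D),
      m.comp (pullbackFst D) = q₁ ∧ m.comp (pullbackSnd D) = q₂ := by
  have hst : ∀ x, p.onState (q₁.onState x) = f.onState (q₂.onState x) := fun x => by
    rw [← Semiconj.onState_comp, ← Semiconj.onState_comp, h]
  let vert : C.graph.V → PullbackVertex p f := fun v =>
    PullbackVertex.ofState (v₁ := q₁.graph.vert v) (v₂ := q₂.graph.vert v) <| by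
      obtain ⟨x, hx⟩ := hC v
      exact ⟨q₁.onState ⟨v, x, hx⟩, q₂.onState ⟨v, x, hx⟩, rfl, rfl, hst _⟩
  have hmap : ∀ v, ∃ γ : SmoothMap (C.activeSet v) (D (vert v)).obj,
      γ.comp (D (vert v)).fst = q₁.map v ∧ γ.comp (D (vert v)).snd = q₂.map v := fun v =>
    (D (vert v)).exists_lift (C.activeSet v) (q₁.map v) (q₂.map v)
      (congrArg (fun s : Semiconj C H => (⟨s.graph.vert v, s.map v⟩ :
        Σ w, SmoothMap (C.activeSet v) (H.activeSet w))) h)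
  choose map hmap₁ hmap₂ using hmap
  have hedge : ∀ e, ∃ g : (pullbackData D).graph.V ⊕ (pullbackData D).graph.E,
      (pullbackFst D).graph.ext' g = q₁.graph.edge e ∧
      (pullbackSnd D).graph.ext' g = q₂.graph.edge e := by
    intro e
    -- An edge collapsed by both maps must go to a vertex, necessarily the image of its source; any
    -- other edge goes to an edge.
    by_cases he : ∃ v₁ v₂, (q₁.graph.edge e, q₂.graph.edge e) = (Sum.inl v₁, Sum.inl v₂)
    · obtain ⟨v₁, v₂, hv⟩ := he
      obtain ⟨h₁, h₂⟩ := Prod.mk.inj hv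
      refine ⟨Sum.inl (vert (C.graph.src e)), ?_, ?_⟩
      · rw [h₁]
        have := q₁.graph.src_edge e
        rw [h₁] at this
        exact congrArg Sum.inl this.symm
      · rw [h₂]
        have := q₂.graph.src_edge e
        rw [h₂] at this
        exact congrArg Sum.inl this.symm
    · obtain ⟨z, hz⟩ := hCe e
      exact ⟨Sum.inr ⟨(q₁.graph.edge e, q₂.graph.edge e), fun v₁ v₂ hv => he ⟨v₁, v₂, hv⟩,
        congrArg (fun s : Semiconj C H => s.graph.edge e) h, _, _, _, _,
        q₁.map_reset e ⟨z, hz⟩, q₂.map_reset e ⟨z, hz⟩, hst _⟩, rfl, rfl⟩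
  choose edge hedge₁ hedge₂ using hedge
  let graph : DiGraph.Hom C.graph (pullbackData D).graph :=
    { vert := vert
      edge := edge
      src_edge := fun e => pullback_vertex_ext
        (by
          rw [← DiGraph.Hom.srcExt_ext', hedge₁]
          exact q₁.graph.src_edge e)
        (by
          rw [← DiGraph.Hom.srcExt_ext', hedge₂]
          exact q₂.graph.src_edge e)
      tgt_edge := fun e => pullback_vertex_ext
        (by
          rw [← DiGraph.Hom.tgtExt_ext', hedge₁]
          exact q₁.graph.tgt_edge e)
        (by
          rw [← DiGraph.Hom.tgtExt_ext', hedge₂]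
          exact q₂.graph.tgt_edge e) }
  have happ₁ : ∀ v x, (D (vert v)).fst.apply ((map v).apply x) = (q₁.map v).apply x := fun v x =>
    (SmoothMap.apply_comp _ _ _).symm.trans (congrArg (fun s => s.apply x) (hmap₁ v))
  have happ₂ : ∀ v x, (D (vert v)).snd.apply ((map v).apply x) = (q₂.map v).apply x := fun v x =>
    (SmoothMap.apply_comp _ _ _).symm.trans (congrArg (fun s => s.apply x) (hmap₂ v))
  have hst₁ : ∀ x, (pullbackFst D).onState (stateMap graph map x) = q₁.onState x :=
    fun x => congrArg (Sigma.mk _) (happ₁ x.1 x.2)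
  have hst₂ : ∀ x, (pullbackSnd D).onState (stateMap graph map x) = q₂.onState x :=
    fun x => congrArg (Sigma.mk _) (happ₂ x.1 x.2)
  have hflow : ∀ v (x : C.active v), (x : C.mode v) ∈ C.flow v →
      ((D (vert v)).fst.apply ((map v).apply x) : K₁.mode (vert v).1.1) ∈
        K₁.flow (vert v).1.1 ∧
      ((D (vert v)).snd.apply ((map v).apply x) : K₂.mode (vert v).1.2) ∈
        K₂.flow (vert v).1.2 := fun v x hx => by
    have h₁ := q₁.map_flow v x hx
    have h₂ := q₂.map_flow v x hx
    rw [← happ₁] at h₁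
    rw [← happ₂] at h₂
    exact ⟨h₁, h₂⟩
  refine ⟨{ graph := graph
            map := map
            map_flow := fun v x hx => ⟨((map v).apply x).2, hflow v x hx⟩
            map_field := fun v => (D (vert v)).lift_semiconj _ (map v) (C.field v) _ _
              (hflow v) ?_ ?_
            map_reset := fun e z => pullback_resets ?_ ?_ }, ?_, ?_⟩
  · rw [hmap₁]
    exact q₁.map_field v
  · rw [hmap₂]
    exact q₂.map_field v
  · rw [hst₁, hst₁, hedge₁]
    exact q₁.map_reset e z
  · rw [hst₂, hst₂, hedge₂]
    exact q₂.map_reset e z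
  · exact Semiconj.ext_of rfl (funext hedge₁) fun v => heq_of_eq (hmap₁ v)
  · exact Semiconj.ext_of rfl (funext hedge₂) fun v => heq_of_eq (hmap₂ v)

end Pullback

/-- The pair of points recorded in a `PullbackVertex` shows both that the two vertices have the same
image and that the fiber product of the active sets is nonempty. -/
theorem nonempty_modeData {K₁ K₂ H : HybridData.{u}} (p : Semiconj K₁ H)
    (hp : ∀ v, (p.map v).IsSubmersion) (f : Semiconj K₂ H) : Nonempty (ModeData p f) :=
  Classical.nonempty_pi.2 fun v => by
    have hv : p.graph.vert v.1.1 = f.graph.vert v.1.2 := by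
      obtain ⟨x₁, x₂, h⟩ := v.2
      exact (Sigma.mk.inj h).1
    exact nonempty_fiberProduct (β := f.map v.1.2) hv (hp v.1.1) (K₁.field v.1.1)
      (K₂.field v.1.2) H.field (p.map_field v.1.1) (f.map_field v.1.2) v.2

end HybSys

theorem mainTheorem4 {K₁ K₂ H : HybSys.HybridSystem.{u}} (p : K₁ ⟶ H)
    (hp : HybSys.IsHybridSubmersion p) (f : K₂ ⟶ H) :
    CategoryTheory.Limits.HasPullback p f := by
  obtain ⟨D⟩ := HybSys.nonempty_modeData p hp f
  let P : HybSys.HybridSystem.{u} :=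
    { HybSys.pullbackData D with
      active_nonempty := HybSys.pullbackData_active_nonempty
      guard_nonempty := HybSys.pullbackData_guard_nonempty }
  let π₁ : P ⟶ K₁ := HybSys.pullbackFst D
  let π₂ : P ⟶ K₂ := HybSys.pullbackSnd D
  have hw : π₁ ≫ p = π₂ ≫ f := HybSys.pullback_condition D
  have hlift : ∀ s : Limits.PullbackCone p f, ∃ m : s.pt ⟶ P, m ≫ π₁ = s.fst ∧ m ≫ π₂ = s.snd :=
    fun s => HybSys.exists_pullback_lift D s.pt.active_nonempty s.pt.guard_nonempty s.fst s.snd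
      s.condition
  choose m hm₁ hm₂ using hlift
  have hlim : Limits.IsLimit (Limits.PullbackCone.mk π₁ π₂ hw) :=
    Limits.PullbackCone.IsLimit.mk hw m hm₁ hm₂ fun s l h₁ h₂ =>
      HybSys.pullback_hom_ext (h₁.trans (hm₁ s).symm) (h₂.trans (hm₂ s).symm)
  exact ⟨⟨_, hlim⟩⟩
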